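/- Let $\{\xi_i, i\ge 1\}$ be independent identically distributed real random variables with $E\xi_i=0$, $D\xi_i=\sigma^2$, $\sigma\in(0,\infty)$, and distribution function $F$. Let $\Phi$ be the standard normal distribution function, let $\Phi_n$ be the distribution function of $S_n=(\sigma\sqrt n)^{-1}(\xi_1+\cdots+\xi_n)$, and put $H(x)=F(x\sigma)-\Phi(x)$, with Lebesgue--Stieltjes signed measure $dH$ and total variation measure $|dH|$. Assume that - $\xi_i$ has a bounded density $p$ with $p(x)\le A_1$ for all $x\in\mathbb R$; - for some integer $m\ge 3$ the pseudomoments $\mu_k=\int_{\mathbb R}x^k\,dH(x)$, $k=3,\dots,m$, exist (that is, $\int_{\mathbb R}|x|^k\,|dH(x)|<\infty$) and are all equal to $0$. For $n\ge 1$ put $$\nu_n^{(1)}(m)=\int_{|x|\le\sigma\sqrt n}|x|^{m+1}\,|dH(x)|,\qquad \nu_n^{(2)}(m)=\int_{|x|>\sigma\sqrt n}|x|^{m}\,|dH(x)|,\qquad \nu_n(m)=\max\{\nu_n^{(1)}(m),\nu_n^{(2)}(m)\}.$$ Then, for every $n\ge 3$ with $\nu_n(m)<\tfrac12 e^{-3/2}$,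 $$\sup_{x\in\mathbb R}|\Phi_n(x)-\Phi(x)|\le 2C^{(1)}_m\frac{\nu_n^{(1)}(m)}{n^{(m-1)/2}}+2C^{(2)}_m\frac{\nu_n^{(2)}(m)}{n^{(m-2)/2}}+2\sigma A_1 b_1^{\,n-2}+\nu_n(m)\frac{4e^{3/2}}{\pi}\frac{e^{-n/2}}{n},$$ where $$C^{(1)}_m=\frac{12^{(m+1)/2}\,\Gamma\left(\frac{m+1}2\right)}{\pi(m+1)!},\qquad C^{(2)}_m=2C^{(1)}_{m-1},\qquad b_1=\exp\left\{-\frac{1}{96A_1^2\sigma^2(2+\pi)^2}\right\}<1.$$ -/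

import Mathlib

open MeasureTheory ProbabilityTheory

noncomputable section

namespace PseudoCLT

/-- The pseudomoment function `H(x) = F(xσ) - Φ(x)`, where `F` is the distribution function
of the law `L` and `Φ` is the standard normal distribution function. -/
def H (L : Measure ℝ) (σ x : ℝ) : ℝ :=
  cdf L (x * σ) - cdf (gaussianReal 0 1) x

/-- The signed Lebesgue-Stieltjes measure `dH`: the law of `ξ / σ` minus the standard
normal law (see `dH_Iic`). -/
def dH (L : Measure ℝ) [IsFiniteMeasure L] (σ : ℝ) : SignedMeasure ℝ :=
  (L.map (fun x => x / σ)).toSignedMeasure - (gaussianReal 0 1).toSignedMeasure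

/-- `dH` is the signed measure whose distribution function is `H`. -/
theorem dH_Iic (L : Measure ℝ) [IsProbabilityMeasure L] {σ : ℝ} (hσ : 0 < σ) (x : ℝ) :
    dH L σ (Set.Iic x) = H L σ x := by
  have hm : Measurable (fun y : ℝ => y / σ) := measurable_id.div_const σ
  have hs : (fun y : ℝ => y / σ) ⁻¹' Set.Iic x = Set.Iic (x * σ) := by
    ext y
    simp [div_le_iff₀ hσ]
  rw [dH, H, cdf_eq_real, cdf_eq_real, _root_.sub_apply,
    Measure.toSignedMeasure_apply_measurable measurableSet_Iic,
    Measure.toSignedMeasure_apply_measurable measurableSet_Iic,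
    measureReal_def, Measure.map_apply hm measurableSet_Iic, hs, measureReal_def]
  rfl

/-- The pseudomoment `μ_k = ∫ x^k dH(x)`. -/
def pseudomoment (L : Measure ℝ) [IsFiniteMeasure L] (σ : ℝ) (k : ℕ) : ℝ :=
  ∫ᵛ x, x ^ k ∂<•(dH L σ)

/-- The pseudomoment `μ_k` exists: `∫ |x|^k |dH(x)| < ∞`. -/
def PseudomomentExists (L : Measure ℝ) [IsFiniteMeasure L] (σ : ℝ) (k : ℕ) : Prop :=
  (dH L σ).Integrable (fun x : ℝ => x ^ k)

/-- The pseudomoment truncated from above,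
`ν_n^{(1)}(m) = ∫_{|x| ≤ σ√n} |x|^{m+1} |dH(x)|`. -/
def nu1 (L : Measure ℝ) [IsFiniteMeasure L] (σ : ℝ) (n m : ℕ) : ℝ :=
  ∫ x in {x : ℝ | |x| ≤ σ * √(n : ℝ)}, |x| ^ (m + 1) ∂(dH L σ).variation

/-- The pseudomoment truncated from below,
`ν_n^{(2)}(m) = ∫_{|x| > σ√n} |x|^m |dH(x)|`. -/
def nu2 (L : Measure ℝ) [IsFiniteMeasure L] (σ : ℝ) (n m : ℕ) : ℝ :=
  ∫ x in {x : ℝ | σ * √(n : ℝ) < |x|}, |x| ^ m ∂(dH L σ).variation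

/-- `ν_n(m) = max {ν_n^{(1)}(m), ν_n^{(2)}(m)}`. -/
def nu (L : Measure ℝ) [IsFiniteMeasure L] (σ : ℝ) (n m : ℕ) : ℝ :=
  max (nu1 L σ n m) (nu2 L σ n m)

/-- `C_m^{(1)} = 12^{(m+1)/2} Γ((m+1)/2) / (π (m+1)!)`. -/
def C1 (m : ℕ) : ℝ :=
  (12 : ℝ) ^ (((m : ℝ) + 1) / 2) * Real.Gamma (((m : ℝ) + 1) / 2) /
    (Real.pi * (Nat.factorial (m + 1) : ℝ))

/-- `C_m^{(2)} = 2 C_{m-1}^{(1)}` (used for `m ≥ 3`). -/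
def C2 (m : ℕ) : ℝ := 2 * C1 (m - 1)

/-- `b_1 = exp {-1 / (96 A₁² σ² (2+π)²)}`. -/
def b1 (A₁ σ : ℝ) : ℝ :=
  Real.exp (-(1 / (96 * A₁ ^ 2 * σ ^ 2 * (2 + Real.pi) ^ 2)))

/-- The normalized sum `S_n = (σ√n)⁻¹ (ξ_1 + ⋯ + ξ_n)`; the sequence is indexed from `0`. -/
def S {Ω : Type*} (ξ : ℕ → Ω → ℝ) (σ : ℝ) (n : ℕ) (ω : Ω) : ℝ :=
  (σ * √(n : ℝ))⁻¹ * ∑ i ∈ Finset.range n, ξ i ω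

end PseudoCLT

end

/-!
Two laws `μ`, `ν` with integrable difference of characteristic functions over `|t|` satisfy
`|cdf μ x - cdf ν x| ≤ (2π)⁻¹ ∫ |charFun μ t - charFun ν t| / |t| dt`, by Fourier inversion of
`cdf μ - cdf ν`. So it suffices to compare `f ^ n` with `exp (-t² / 2) ^ n`, where `f` is the
characteristic function of `ξ / σ`.

Since the pseudomoments vanish, the Taylor polynomials of order `m` of `f` and of
`exp (-t² / 2)` agree, and the remainder, estimated to order `m + 1` for `|x| ≤ σ√n` and to
order `m` for `|x| > σ√n`, is controlled by `ν⁽¹⁾` and `ν⁽²⁾`. Where `2ν ≤ exp (-t² / 2)` this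
forces `|f t| ≤ exp (-t² / 8)`, and telescoping `f ^ n - exp (-t² / 2) ^ n` produces Gaussian
moments, hence the constants `C⁽¹⁾` and `C⁽²⁾`. Elsewhere `t² ≥ 3` because `ν < exp (-3 / 2) / 2`;
there a density bounded by `A` gives `|f t| ≤ b₁`, and `∫ |f|² ≤ 2πA` by Plancherel makes
`|f| ^ n` integrable.
-/

namespace PseudoCLT

open Real Set Filter Topology FourierTransform
open scoped ENNReal NNReal

/-- The kernel `1_{y ≤ x} - 1_{0 ≤ x}`. Subtracting the step at `0` makes the unit step at `y`
integrable in `x`, so that Fubini's theorem applies to distribution functions. -/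
noncomputable def stepKernel (y x : ℝ) : ℝ :=
  (Ici y).indicator 1 x - (Ici 0).indicator 1 x

lemma stepKernel_of_nonpos {y : ℝ} (hy : y ≤ 0) : stepKernel y = (Ico y 0).indicator 1 := by
  ext x
  simp only [stepKernel, indicator, mem_Ici, mem_Ico, Pi.one_apply]
  split_ifs <;> grind

lemma stepKernel_of_nonneg {y : ℝ} (hy : 0 ≤ y) : stepKernel y = -(Ico 0 y).indicator 1 := by
  ext x
  simp only [stepKernel, indicator, mem_Ici, mem_Ico, Pi.one_apply, Pi.neg_apply]
  split_ifs <;> grind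

lemma measurable_uncurry_stepKernel : Measurable (Function.uncurry stepKernel) := by
  have h : Function.uncurry stepKernel =
      {q : ℝ × ℝ | q.1 ≤ q.2}.indicator 1 - {q : ℝ × ℝ | 0 ≤ q.2}.indicator 1 := by
    ext ⟨y, x⟩
    simp [stepKernel, Function.uncurry, indicator]
  rw [h]
  exact (measurable_one.indicator (measurableSet_le measurable_fst measurable_snd)).sub
    (measurable_one.indicator (measurableSet_le measurable_const measurable_snd))

lemma integrable_stepKernel (y : ℝ) : Integrable (stepKernel y) := by
  rcases le_total y 0 with hy | hy
  · rw [stepKernel_of_nonpos hy, integrable_indicator_iff measurableSet_Ico]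
    exact integrableOn_const (by simp)
  · rw [stepKernel_of_nonneg hy, integrable_neg_iff, integrable_indicator_iff measurableSet_Ico]
    exact integrableOn_const (by simp)

lemma integral_stepKernel_smul {E : Type*} [NormedAddCommGroup E] [NormedSpace ℝ E] (y : ℝ)
    (c : ℝ → E) : ∫ x, stepKernel y x • c x = ∫ x in y..0, c x := by
  rcases le_total y 0 with hy | hy
  · rw [stepKernel_of_nonpos hy, intervalIntegral.integral_of_le hy,
      ← integral_Ico_eq_integral_Ioc, ← integral_indicator measurableSet_Ico]
    congr 1 with x
    by_cases hx : x ∈ Ico y 0 <;> simp [hx]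
  · rw [stepKernel_of_nonneg hy, intervalIntegral.integral_of_ge hy,
      ← integral_Ico_eq_integral_Ioc, ← integral_indicator measurableSet_Ico, ← integral_neg]
    congr 1 with x
    by_cases hx : x ∈ Ico 0 y <;> simp [hx]

lemma integral_abs_stepKernel (y : ℝ) : ∫ x, |stepKernel y x| = |y| := by
  rcases le_total y 0 with hy | hy
  · have h : (fun x => |stepKernel y x|) = (Ico y 0).indicator 1 := by
      ext x
      by_cases hx : x ∈ Ico y 0 <;> simp [stepKernel_of_nonpos hy, hx]
    simp [h, integral_indicator_one measurableSet_Ico, measureReal_def, abs_of_nonpos hy, hy]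
  · have h : (fun x => |stepKernel y x|) = (Ico 0 y).indicator 1 := by
      ext x
      by_cases hx : x ∈ Ico 0 y <;> simp [stepKernel_of_nonneg hy, hx]
    simp [h, integral_indicator_one measurableSet_Ico, measureReal_def, abs_of_nonneg hy, hy]

lemma integrable_uncurry_stepKernel {μ : Measure ℝ} [SFinite μ]
    (hμ : Integrable (fun x => x) μ) :
    Integrable (Function.uncurry stepKernel) (μ.prod volume) := by
  rw [integrable_prod_iff measurable_uncurry_stepKernel.aestronglyMeasurable]
  refine ⟨.of_forall integrable_stepKernel, ?_⟩
  simpa [Function.uncurry, integral_abs_stepKernel] using hμ.abs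

lemma norm_cexp_ofReal_mul_ofReal_mul_I (t x : ℝ) : ‖Complex.exp (t * x * Complex.I)‖ = 1 := by
  exact_mod_cast Complex.norm_exp_ofReal_mul_I (t * x)

lemma integrable_smul_cexp {f : ℝ → ℝ} (hf : Integrable f) (t : ℝ) :
    Integrable fun x : ℝ => f x • Complex.exp (t * x * Complex.I) := by
  refine hf.mono (hf.1.smul (by fun_prop)) (.of_forall fun x => ?_)
  rw [norm_smul, norm_cexp_ofReal_mul_ofReal_mul_I, mul_one]

section CdfDifference

variable {μ ν : Measure ℝ} [IsProbabilityMeasure μ] [IsProbabilityMeasure ν]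

lemma integral_stepKernel_left (x : ℝ) :
    ∫ y, stepKernel y x ∂μ = cdf μ x - (Ici 0).indicator 1 x := by
  have h : (fun y => stepKernel y x) =
      fun y => (Iic x).indicator (1 : ℝ → ℝ) y - (Ici (0 : ℝ)).indicator (1 : ℝ → ℝ) x := by
    ext y
    simp [stepKernel, indicator]
  rw [h, integral_sub ((integrable_const 1).indicator measurableSet_Iic) (integrable_const _),
    integral_indicator_one measurableSet_Iic, cdf_eq_real]
  simp

lemma integrable_cdf_sub_indicator (hμ : Integrable (fun x => x) μ) :
    Integrable fun x => cdf μ x - (Ici (0 : ℝ)).indicator (1 : ℝ → ℝ) x := by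
  simpa [integral_stepKernel_left] using (integrable_uncurry_stepKernel hμ).integral_prod_right

lemma integral_cdf_sub_indicator_smul_cexp (hμ : Integrable (fun x => x) μ) {t : ℝ} (ht : t ≠ 0) :
    ∫ x, (cdf μ x - (Ici (0 : ℝ)).indicator (1 : ℝ → ℝ) x) • Complex.exp (t * x * Complex.I) =
      (1 - charFun μ t) / (t * Complex.I) := by
  have hint : Integrable (fun q : ℝ × ℝ => stepKernel q.1 q.2 •
      Complex.exp (t * q.2 * Complex.I)) (μ.prod volume) := by
    refine (integrable_uncurry_stepKernel hμ).mono ?_ (.of_forall fun q => ?_)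
    · exact (measurable_uncurry_stepKernel.smul (f := fun q : ℝ × ℝ => stepKernel q.1 q.2)
        (by fun_prop)).aestronglyMeasurable
    · simp [norm_cexp_ofReal_mul_ofReal_mul_I, Function.uncurry]
  have hc : (t * Complex.I : ℂ) ≠ 0 := by simp [ht]
  calc ∫ x, (cdf μ x - (Ici (0 : ℝ)).indicator (1 : ℝ → ℝ) x) • Complex.exp (t * x * Complex.I)
      = ∫ x, ∫ y, stepKernel y x • Complex.exp (t * x * Complex.I) ∂μ := by
        simp_rw [integral_smul_const, integral_stepKernel_left]
    _ = ∫ y, (∫ x, stepKernel y x • Complex.exp (t * x * Complex.I)) ∂μ :=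
        (integral_integral_swap hint).symm
    _ = ∫ y, (1 - Complex.exp (t * y * Complex.I)) / (t * Complex.I) ∂μ := by
        congr 1 with y
        rw [integral_stepKernel_smul]
        simpa [mul_right_comm _ _ Complex.I] using
          integral_exp_mul_complex (a := y) (b := 0) hc
    _ = (1 - charFun μ t) / (t * Complex.I) := by
        rw [integral_div, integral_sub (integrable_const _), charFun_apply_real]
        · simp
        · exact (integrable_const (1 : ℝ)).mono' (by fun_prop)
            (.of_forall fun y => (norm_cexp_ofReal_mul_ofReal_mul_I t y).le)

lemma integrable_cdf_sub_cdf (hμ : Integrable (fun x => x) μ) (hν : Integrable (fun x => x) ν) :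
    Integrable fun x => cdf μ x - cdf ν x :=
  ((integrable_cdf_sub_indicator hμ).sub (integrable_cdf_sub_indicator hν)).congr
    (.of_forall fun _ => sub_sub_sub_cancel_right _ _ _)

lemma integral_cdf_sub_cdf_smul_cexp (hμ : Integrable (fun x => x) μ)
    (hν : Integrable (fun x => x) ν) {t : ℝ} (ht : t ≠ 0) :
    ∫ x, (cdf μ x - cdf ν x) • Complex.exp (t * x * Complex.I) =
      (charFun ν t - charFun μ t) / (t * Complex.I) := by
  rw [← sub_sub_sub_cancel_left (charFun μ t) (charFun ν t) 1, sub_div,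
    ← integral_cdf_sub_indicator_smul_cexp hμ ht, ← integral_cdf_sub_indicator_smul_cexp hν ht,
    ← integral_sub (integrable_smul_cexp (integrable_cdf_sub_indicator hμ) t)
      (integrable_smul_cexp (integrable_cdf_sub_indicator hν) t)]
  simp_rw [← sub_smul, sub_sub_sub_cancel_right]

lemma norm_fourier_cdf_sub_cdf (hμ : Integrable (fun x => x) μ) (hν : Integrable (fun x => x) ν)
    {w : ℝ} (hw : w ≠ 0) :
    ‖𝓕 (fun x => ((cdf μ x - cdf ν x : ℝ) : ℂ)) w‖ =
      ‖charFun μ (-(2 * π) * w) - charFun ν (-(2 * π) * w)‖ / |-(2 * π) * w| := by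
  have h : 𝓕 (fun x => ((cdf μ x - cdf ν x : ℝ) : ℂ)) w =
      ∫ x, (cdf μ x - cdf ν x) • Complex.exp ((-(2 * π) * w : ℝ) * x * Complex.I) := by
    rw [Real.fourier_real_eq_integral_exp_smul]
    congr 1 with x
    rw [smul_eq_mul, Complex.real_smul, mul_comm]
    congr 2
    push_cast
    ring
  rw [h, integral_cdf_sub_cdf_smul_cexp hμ hν (by simp [hw, pi_ne_zero]), norm_div, norm_mul,
    Complex.norm_I, mul_one, Complex.norm_real, norm_sub_rev, Real.norm_eq_abs]

lemma abs_cdf_sub_cdf_le_of_continuousAt (hμ : Integrable (fun x => x) μ)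
    (hν : Integrable (fun x => x) ν)
    (h : Integrable fun t : ℝ => ‖charFun μ t - charFun ν t‖ / |t|) {x : ℝ}
    (hx : ContinuousAt (fun y => cdf μ y - cdf ν y) x) :
    |cdf μ x - cdf ν x| ≤ (2 * π)⁻¹ * ∫ t : ℝ, ‖charFun μ t - charFun ν t‖ / |t| := by
  set D : ℝ → ℂ := fun y => ((cdf μ y - cdf ν y : ℝ) : ℂ)
  have hD : Integrable D := (integrable_cdf_sub_cdf hμ hν).ofReal
  have hnorm : (fun w => ‖𝓕 D w‖) =ᵐ[volume] fun w : ℝ =>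
      ‖charFun μ (-(2 * π) * w) - charFun ν (-(2 * π) * w)‖ / |-(2 * π) * w| := by
    filter_upwards [compl_mem_ae_iff.2 (measure_singleton (0 : ℝ))] with w hw
      using norm_fourier_cdf_sub_cdf hμ hν hw
  have hcont : Continuous (𝓕 D) :=
    VectorFourier.fourierIntegral_continuous continuous_fourierChar (by exact continuous_inner) hD
  have hFD : Integrable (𝓕 D) := by
    rw [← integrable_norm_iff hcont.aestronglyMeasurable]
    exact (h.comp_mul_left' (neg_ne_zero.2 two_pi_pos.ne')).congr hnorm.symm
  calc |cdf μ x - cdf ν x| = ‖𝓕⁻ (𝓕 D) x‖ := by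
        rw [hD.fourierInv_fourier_eq hFD (Complex.continuous_ofReal.continuousAt.comp hx),
          Complex.norm_real, Real.norm_eq_abs]
    _ ≤ ∫ w, ‖𝓕 D w‖ := by
        rw [Real.fourierInv_eq_fourier_neg]
        exact VectorFourier.norm_fourierIntegral_le_integral_norm _ _ _ _ _
    _ = ∫ w : ℝ, ‖charFun μ (-(2 * π) * w) - charFun ν (-(2 * π) * w)‖ / |-(2 * π) * w| :=
        integral_congr_ae hnorm
    _ = (2 * π)⁻¹ * ∫ t : ℝ, ‖charFun μ t - charFun ν t‖ / |t| := by
        rw [Measure.integral_comp_mul_left (fun t : ℝ => ‖charFun μ t - charFun ν t‖ / |t|),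
          inv_neg, abs_neg, abs_of_pos (by positivity), smul_eq_mul]

theorem abs_cdf_sub_cdf_le (hμ : Integrable (fun x => x) μ) (hν : Integrable (fun x => x) ν)
    (h : Integrable fun t : ℝ => ‖charFun μ t - charFun ν t‖ / |t|) (x : ℝ) :
    |cdf μ x - cdf ν x| ≤ (2 * π)⁻¹ * ∫ t : ℝ, ‖charFun μ t - charFun ν t‖ / |t| := by
  -- A distribution function is right continuous and has countably many jumps, so the bound at
  -- the common continuity points to the right of `x` passes to the limit.
  set C : Set ℝ := {y | ContinuousAt (cdf μ) y} ∩ {y | ContinuousAt (cdf ν) y}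
  have hcount : Cᶜ.Countable := by
    rw [compl_inter]
    exact (monotone_cdf μ).countable_not_continuousAt.union
      (monotone_cdf ν).countable_not_continuousAt
  have hdense : Dense C := by simpa using hcount.dense_compl ℝ
  have hmem : x ∈ closure (Ioi x ∩ C) :=
    closure_minimal (hdense.open_subset_closure_inter isOpen_Ioi) isClosed_closure (by simp)
  have : (𝓝[Ioi x ∩ C] x).NeBot := mem_closure_iff_nhdsWithin_neBot.1 hmem
  have hsub : Ioi x ∩ C ⊆ Ici x := inter_subset_left.trans Ioi_subset_Ici_self
  have hlim : Tendsto (fun y => |cdf μ y - cdf ν y|) (𝓝[Ioi x ∩ C] x)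
      (𝓝 |cdf μ x - cdf ν x|) :=
    ((((cdf μ).right_continuous x).mono hsub).sub (((cdf ν).right_continuous x).mono hsub)).abs
  refine le_of_tendsto hlim ?_
  filter_upwards [self_mem_nhdsWithin] with y hy
  exact abs_cdf_sub_cdf_le_of_continuousAt hμ hν h (hy.2.1.sub hy.2.2)

end CdfDifference

lemma norm_charFun_sq_eq_integral_prod (μ : Measure ℝ) [IsFiniteMeasure μ] (t : ℝ) :
    ((‖charFun μ t‖ ^ 2 : ℝ) : ℂ) =
      ∫ q : ℝ × ℝ, Complex.exp (t * (q.1 - q.2) * Complex.I) ∂(μ.prod μ) := by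
  have hmul : ∀ q : ℝ × ℝ, Complex.exp (t * (q.1 - q.2) * Complex.I) =
      Complex.exp (t * q.1 * Complex.I) * Complex.exp ((-t : ℝ) * q.2 * Complex.I) := by
    intro q
    rw [← Complex.exp_add]
    congr 1
    push_cast
    ring
  simp_rw [hmul]
  rw [integral_prod_mul (fun x : ℝ => Complex.exp (t * x * Complex.I))
    (fun x : ℝ => Complex.exp ((-t : ℝ) * x * Complex.I)), ← charFun_apply_real,
    ← charFun_apply_real, charFun_neg, Complex.mul_conj, Complex.normSq_eq_norm_sq]

lemma integral_norm_charFun_sq_gaussianReal (μ : Measure ℝ) [IsFiniteMeasure μ] (v : ℝ≥0) :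
    ∫ t, ‖charFun μ t‖ ^ 2 ∂(gaussianReal 0 v) =
      ∫ q : ℝ × ℝ, rexp (-(v * (q.1 - q.2) ^ 2 / 2)) ∂(μ.prod μ) := by
  have hint : Integrable (fun z : ℝ × (ℝ × ℝ) =>
      Complex.exp (z.1 * (z.2.1 - z.2.2) * Complex.I)) ((gaussianReal 0 v).prod (μ.prod μ)) := by
    refine (integrable_const (1 : ℝ)).mono' (by fun_prop) (.of_forall fun z => le_of_eq ?_)
    exact_mod_cast norm_cexp_ofReal_mul_ofReal_mul_I z.1 (z.2.1 - z.2.2)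
  rw [← Complex.ofReal_inj, ← integral_complex_ofReal, ← integral_complex_ofReal]
  simp_rw [norm_charFun_sq_eq_integral_prod]
  rw [integral_integral_swap hint]
  congr 1 with q
  have hgauss := charFun_gaussianReal (μ := 0) (v := v) (q.1 - q.2)
  rw [charFun_apply_real] at hgauss
  push_cast at hgauss ⊢
  simp_rw [mul_comm _ ((q.1 : ℂ) - q.2)]
  rw [hgauss]
  congr 1
  ring

section BoundedDensity

variable {μ : Measure ℝ} {A : ℝ}

lemma lintegral_exp_neg_mul_sq_sub_le (hA : 0 ≤ A) (hμ : μ ≤ ENNReal.ofReal A • volume) {v : ℝ}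
    (hv : 0 < v) (y : ℝ) :
    ∫⁻ x, ENNReal.ofReal (rexp (-(v * (x - y) ^ 2 / 2))) ∂μ ≤
      ENNReal.ofReal (A * √(2 * π / v)) := by
  have hexp : ∀ x : ℝ, rexp (-(v * x ^ 2 / 2)) = rexp (-(v / 2) * x ^ 2) := fun x => by
    congr 1; ring
  calc ∫⁻ x, ENNReal.ofReal (rexp (-(v * (x - y) ^ 2 / 2))) ∂μ
      ≤ ∫⁻ x, ENNReal.ofReal (rexp (-(v * (x - y) ^ 2 / 2))) ∂(ENNReal.ofReal A • volume) :=
        lintegral_mono' hμ le_rfl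
    _ = ENNReal.ofReal A * ∫⁻ x, ENNReal.ofReal (rexp (-(v * x ^ 2 / 2))) := by
        rw [lintegral_smul_measure, smul_eq_mul, lintegral_sub_right_eq_self
          (fun x : ℝ => ENNReal.ofReal (rexp (-(v * x ^ 2 / 2)))) y]
    _ = ENNReal.ofReal (A * √(2 * π / v)) := by
        simp_rw [hexp]
        rw [← ofReal_integral_eq_lintegral_ofReal (integrable_exp_neg_mul_sq (by positivity))
          (.of_forall fun x => (exp_pos _).le), integral_gaussian, ENNReal.ofReal_mul hA]
        congr 3
        field_simp

variable [IsProbabilityMeasure μ]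

lemma lintegral_norm_charFun_sq_gaussianReal_le (hA : 0 ≤ A)
    (hμ : μ ≤ ENNReal.ofReal A • volume) {v : ℝ≥0} (hv : v ≠ 0) :
    ∫⁻ t, ENNReal.ofReal (‖charFun μ t‖ ^ 2) ∂(gaussianReal 0 v) ≤
      ENNReal.ofReal (A * √(2 * π / v)) := by
  have hcharFun : Integrable (fun t => ‖charFun μ t‖ ^ 2) (gaussianReal 0 v) := by
    refine (integrable_const (1 : ℝ)).mono' (by fun_prop) (.of_forall fun t => ?_)
    rw [Real.norm_of_nonneg (by positivity)]
    exact pow_le_one₀ (norm_nonneg _) (norm_charFun_le_one t)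
  have hexp : Integrable (fun q : ℝ × ℝ => rexp (-(v * (q.1 - q.2) ^ 2 / 2))) (μ.prod μ) := by
    refine (integrable_const (1 : ℝ)).mono' (by fun_prop) (.of_forall fun q => ?_)
    rw [Real.norm_of_nonneg (exp_pos _).le, exp_le_one_iff, neg_nonpos]
    positivity
  rw [← ofReal_integral_eq_lintegral_ofReal hcharFun (.of_forall fun t => by positivity),
    integral_norm_charFun_sq_gaussianReal, ofReal_integral_eq_lintegral_ofReal hexp
    (.of_forall fun t => (exp_pos _).le), lintegral_prod_symm' _ (by fun_prop)]
  calc ∫⁻ y, ∫⁻ x, ENNReal.ofReal (rexp (-(v * (x - y) ^ 2 / 2))) ∂μ ∂μ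
      ≤ ∫⁻ _, ENNReal.ofReal (A * √(2 * π / v)) ∂μ :=
        lintegral_mono fun y => lintegral_exp_neg_mul_sq_sub_le hA hμ (by positivity) y
    _ = ENNReal.ofReal (A * √(2 * π / v)) := by simp

lemma lintegral_exp_mul_norm_charFun_sq_le (hA : 0 ≤ A) (hμ : μ ≤ ENNReal.ofReal A • volume)
    {v : ℝ≥0} (hv : v ≠ 0) :
    ∫⁻ t, ENNReal.ofReal (rexp (-(t ^ 2 / (2 * v))) * ‖charFun μ t‖ ^ 2) ≤
      ENNReal.ofReal (2 * π * A) := by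
  have hmeas : Measurable fun t => ENNReal.ofReal (‖charFun μ t‖ ^ 2) := by fun_prop
  have hpdf : ∀ t, ENNReal.ofReal (rexp (-(t ^ 2 / (2 * v))) * ‖charFun μ t‖ ^ 2) =
      ENNReal.ofReal (√(2 * π * v)) *
        (gaussianPDF 0 v * fun t => ENNReal.ofReal (‖charFun μ t‖ ^ 2)) t := by
    intro t
    rw [Pi.mul_apply, gaussianPDF_def, ← ENNReal.ofReal_mul (gaussianPDFReal_nonneg _ _ _),
      ← ENNReal.ofReal_mul (by positivity), gaussianPDFReal_def]
    simp only [sub_zero]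
    congr 1
    field_simp
  have hsqrt : √(2 * π * v) * √(2 * π / v) = 2 * π := by
    rw [← Real.sqrt_mul (by positivity),
      show 2 * π * v * (2 * π / v) = (2 * π) ^ 2 by field_simp, Real.sqrt_sq (by positivity)]
  calc ∫⁻ t, ENNReal.ofReal (rexp (-(t ^ 2 / (2 * v))) * ‖charFun μ t‖ ^ 2)
      = ENNReal.ofReal (√(2 * π * v)) *
          ∫⁻ t, ENNReal.ofReal (‖charFun μ t‖ ^ 2) ∂(gaussianReal 0 v) := by
        simp_rw [hpdf]
        rw [lintegral_const_mul _ ((measurable_gaussianPDF 0 v).mul hmeas),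
          gaussianReal_of_var_ne_zero _ hv,
          lintegral_withDensity_eq_lintegral_mul _ (measurable_gaussianPDF 0 v) hmeas]
    _ ≤ ENNReal.ofReal (√(2 * π * v)) * ENNReal.ofReal (A * √(2 * π / v)) := by
        gcongr
        exact lintegral_norm_charFun_sq_gaussianReal_le hA hμ hv
    _ = ENNReal.ofReal (2 * π * A) := by
        rw [← ENNReal.ofReal_mul (by positivity), mul_left_comm, hsqrt, mul_comm]

theorem lintegral_norm_charFun_sq_le (hA : 0 ≤ A) (hμ : μ ≤ ENNReal.ofReal A • volume) :
    ∫⁻ t, ENNReal.ofReal (‖charFun μ t‖ ^ 2) ≤ ENNReal.ofReal (2 * π * A) := by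
  set f : ℕ → ℝ → ℝ≥0∞ := fun k t =>
    ENNReal.ofReal (rexp (-(t ^ 2 / (2 * ((k + 1 : ℕ) : ℝ≥0)))) * ‖charFun μ t‖ ^ 2)
  have hlim : ∀ t, Tendsto (f · t) atTop (𝓝 (ENNReal.ofReal (‖charFun μ t‖ ^ 2))) := by
    intro t
    refine ENNReal.tendsto_ofReal ?_
    have hatTop : Tendsto (fun k : ℕ => 2 * ((k : ℝ) + 1)) atTop atTop :=
      (tendsto_atTop_add_const_right _ _ tendsto_natCast_atTop_atTop).const_mul_atTop two_pos
    simpa using ((continuous_exp.tendsto _).comp (hatTop.const_div_atTop (t ^ 2)).neg).mul_const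
      (‖charFun μ t‖ ^ 2)
  calc ∫⁻ t, ENNReal.ofReal (‖charFun μ t‖ ^ 2) = ∫⁻ t, liminf (f · t) atTop := by
        congr 1 with t
        exact (hlim t).liminf_eq.symm
    _ ≤ liminf (fun k => ∫⁻ t, f k t) atTop := lintegral_liminf_le fun k => by fun_prop
    _ ≤ liminf (fun _ : ℕ => ENNReal.ofReal (2 * π * A)) atTop :=
        liminf_le_liminf (.of_forall fun k =>
          lintegral_exp_mul_norm_charFun_sq_le hA hμ (by positivity))
    _ = ENNReal.ofReal (2 * π * A) := by simp

lemma integrable_norm_charFun_sq (hA : 0 ≤ A) (hμ : μ ≤ ENNReal.ofReal A • volume) :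
    Integrable fun t => ‖charFun μ t‖ ^ 2 := by
  refine ⟨by fun_prop, ?_⟩
  rw [hasFiniteIntegral_iff_ofReal (.of_forall fun t => by positivity)]
  exact (lintegral_norm_charFun_sq_le hA hμ).trans_lt ENNReal.ofReal_lt_top

lemma integral_norm_charFun_sq_le (hA : 0 ≤ A) (hμ : μ ≤ ENNReal.ofReal A • volume) :
    ∫ t, ‖charFun μ t‖ ^ 2 ≤ 2 * π * A := by
  rw [← ENNReal.ofReal_le_ofReal_iff (by positivity),
    ofReal_integral_eq_lintegral_ofReal (integrable_norm_charFun_sq hA hμ)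
      (.of_forall fun t => by positivity)]
  exact lintegral_norm_charFun_sq_le hA hμ

end BoundedDensity

lemma card_Icc_ceil_floor_le {a b : ℝ} (hab : a ≤ b) :
    ((Finset.Icc ⌈a⌉ ⌊b⌋).card : ℝ) ≤ b - a + 1 := by
  have hcard : ((Finset.Icc ⌈a⌉ ⌊b⌋).card : ℤ) = max (⌊b⌋ + 1 - ⌈a⌉) 0 := by
    rw [Int.card_Icc, Int.toNat_eq_max]
  have hcard' : ((Finset.Icc ⌈a⌉ ⌊b⌋).card : ℝ) = max ((⌊b⌋ : ℝ) + 1 - ⌈a⌉) 0 := by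
    exact_mod_cast hcard
  rw [hcard']
  exact max_le (by linarith [Int.floor_le b, Int.le_ceil a]) (by linarith)

lemma near_period_subset_iUnion_closedBall {t : ℝ} (ht : t ≠ 0) (θ R ε : ℝ) :
    {x : ℝ | |x| ≤ R ∧ ∃ k : ℤ, |t * x - θ - 2 * π * k| ≤ ε} ⊆
      ⋃ k ∈ Finset.Icc ⌈(-θ - (R * |t| + ε)) / (2 * π)⌉ ⌊(-θ + (R * |t| + ε)) / (2 * π)⌋,
        Metric.closedBall ((θ + 2 * π * k) / t) (ε / |t|) := by
  rintro x ⟨hx, k, hk⟩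
  refine mem_iUnion₂.2 ⟨k, ?_, ?_⟩
  · have htx : |t * x| ≤ R * |t| := by rw [abs_mul, mul_comm]; gcongr
    rw [Finset.mem_Icc, Int.ceil_le, Int.le_floor, div_le_iff₀ two_pi_pos,
      le_div_iff₀ two_pi_pos]
    rw [abs_le] at hk htx
    constructor <;> linarith
  · have hcenter : (x - (θ + 2 * π * k) / t) * t = t * x - θ - 2 * π * k := by
      field_simp
      ring
    rwa [Metric.mem_closedBall, Real.dist_eq, le_div_iff₀ (abs_pos.2 ht), ← abs_mul, hcenter]

lemma two_mul_sq_div_pi_sq_le_one_sub_cos {y ε : ℝ} (hε : 0 ≤ ε)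
    (h : ∀ k : ℤ, ε < |y - 2 * π * k|) : 2 * ε ^ 2 / π ^ 2 ≤ 1 - cos y := by
  set k := round (y / (2 * π))
  have hround : |y / (2 * π) - k| ≤ 1 / 2 := abs_sub_round _
  have hdist : |y - 2 * π * k| ≤ π := by
    rw [show y - 2 * π * k = 2 * π * (y / (2 * π) - k) by field_simp, abs_mul,
      abs_of_pos two_pi_pos]
    nlinarith [pi_pos]
  calc 2 * ε ^ 2 / π ^ 2 ≤ 2 * |y - 2 * π * k| ^ 2 / π ^ 2 := by gcongr; exact (h k).le
    _ = 2 / π ^ 2 * (y - 2 * π * k) ^ 2 := by rw [sq_abs]; ring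
    _ ≤ 1 - cos (y - 2 * π * k) := by linarith [cos_le_one_sub_mul_cos_sq hdist]
    _ = 1 - cos y := by rw [mul_comm (2 * π), cos_sub_int_mul_two_pi]

lemma exists_norm_charFun_eq_integral_cos (μ : Measure ℝ) [IsFiniteMeasure μ] (t : ℝ) :
    ∃ θ : ℝ, ‖charFun μ t‖ = ∫ x, cos (t * x - θ) ∂μ := by
  set θ := (charFun μ t).arg with hθ
  refine ⟨θ, ?_⟩
  have hint : Integrable (fun x : ℝ => Complex.exp ((t * x - θ : ℝ) * Complex.I)) μ :=
    (integrable_const (1 : ℝ)).mono' (by fun_prop)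
      (.of_forall fun x => (Complex.norm_exp_ofReal_mul_I _).le)
  have hrotate : (‖charFun μ t‖ : ℂ) = ∫ x, Complex.exp ((t * x - θ : ℝ) * Complex.I) ∂μ := by
    have hmul : ∀ x : ℝ, Complex.exp ((t * x - θ : ℝ) * Complex.I) =
        Complex.exp (t * x * Complex.I) * Complex.exp (-(θ * Complex.I)) := fun x => by
      rw [← Complex.exp_add]; congr 1; push_cast; ring
    simp_rw [hmul]
    rw [integral_mul_const, ← charFun_apply_real]
    conv_rhs => rw [← Complex.norm_mul_exp_arg_mul_I (charFun μ t)]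
    rw [mul_assoc, ← Complex.exp_add]
    simp [hθ]
  rw [← Complex.ofReal_re ‖charFun μ t‖, hrotate, ← RCLike.re_eq_complex_re, ← integral_re hint]
  congr 1 with x
  rw [RCLike.re_eq_complex_re, Complex.exp_ofReal_mul_I_re]

lemma mul_measureReal_le_one_sub_norm_charFun {μ : Measure ℝ} [IsProbabilityMeasure μ]
    {t θ c : ℝ} (hθ : ‖charFun μ t‖ = ∫ x, cos (t * x - θ) ∂μ) (hc : 0 ≤ c) {G : Set ℝ}
    (hG : ∀ x ∈ G, c ≤ 1 - cos (t * x - θ)) : c * μ.real G ≤ 1 - ‖charFun μ t‖ := by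
  have hcos : Integrable (fun x => cos (t * x - θ)) μ :=
    (integrable_const (1 : ℝ)).mono' (by fun_prop) (.of_forall fun x => abs_cos_le_one _)
  calc c * μ.real G ≤ c * μ.real {x | c ≤ 1 - cos (t * x - θ)} :=
        mul_le_mul_of_nonneg_left (measureReal_mono hG) hc
    _ ≤ ∫ x, (1 - cos (t * x - θ)) ∂μ :=
        mul_meas_ge_le_integral_of_nonneg (.of_forall fun x => sub_nonneg.2 (cos_le_one _))
          ((integrable_const 1).sub hcos) c
    _ = 1 - ‖charFun μ t‖ := by
        rw [integral_sub (integrable_const _) hcos, hθ]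
        simp

lemma three_quarters_le_measureReal_Icc {μ : Measure ℝ} [IsProbabilityMeasure μ]
    (hint : Integrable (fun x => x ^ 2) μ) (hvar : ∫ x, x ^ 2 ∂μ ≤ 1) :
    3 / 4 ≤ μ.real (Icc (-2) 2) := by
  have hmarkov := mul_meas_ge_le_integral_of_nonneg (μ := μ) (f := fun x => x ^ 2)
    (.of_forall fun x => sq_nonneg x) hint 4
  have hcompl : μ.real (Icc (-2) 2)ᶜ ≤ μ.real {x | 4 ≤ x ^ 2} := by
    refine measureReal_mono fun x hx => ?_
    by_contra hx'
    simp only [mem_ofPred_eq, not_le] at hx'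
    exact hx ⟨by nlinarith, by nlinarith⟩
  rw [probReal_compl_eq_one_sub measurableSet_Icc] at hcompl
  linarith

section BoundedDensity

variable {μ : Measure ℝ} {A : ℝ}

lemma measureReal_le_mul_volume (hA : 0 ≤ A) (hμ : μ ≤ ENNReal.ofReal A • volume) {s : Set ℝ}
    (hs : volume s ≠ ∞) : μ.real s ≤ A * volume.real s := by
  have h := ENNReal.toReal_mono (ENNReal.mul_ne_top ENNReal.ofReal_ne_top hs) (hμ s)
  rwa [ENNReal.toReal_mul, ENNReal.toReal_ofReal hA] at h

variable [IsProbabilityMeasure μ]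

lemma measureReal_near_period_le (hA : 0 ≤ A) (hμ : μ ≤ ENNReal.ofReal A • volume) {t : ℝ}
    (ht : t ≠ 0) (θ : ℝ) {R ε : ℝ} (hR : 0 ≤ R) (hε : 0 ≤ ε) :
    μ.real {x | |x| ≤ R ∧ ∃ k : ℤ, |t * x - θ - 2 * π * k| ≤ ε} ≤
      ((R * |t| + ε) / π + 1) * (A * (2 * (ε / |t|))) := by
  set c := R * |t| + ε
  have hc : 0 ≤ c := by positivity
  set K : Finset ℤ := Finset.Icc ⌈(-θ - c) / (2 * π)⌉ ⌊(-θ + c) / (2 * π)⌋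
  have hcard : (K.card : ℝ) ≤ c / π + 1 := by
    convert card_Icc_ceil_floor_le (a := (-θ - c) / (2 * π)) (b := (-θ + c) / (2 * π)) (by
      gcongr; linarith) using 2
    field_simp
    ring
  have hball : ∀ k : ℤ, μ.real (Metric.closedBall ((θ + 2 * π * k) / t) (ε / |t|)) ≤
      A * (2 * (ε / |t|)) := by
    intro k
    refine (measureReal_le_mul_volume hA hμ measure_closedBall_lt_top.ne).trans_eq ?_
    rw [Real.volume_real_closedBall (by positivity)]
  calc μ.real {x | |x| ≤ R ∧ ∃ k : ℤ, |t * x - θ - 2 * π * k| ≤ ε}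
      ≤ μ.real (⋃ k ∈ K, Metric.closedBall ((θ + 2 * π * k) / t) (ε / |t|)) :=
        measureReal_mono (near_period_subset_iUnion_closedBall ht θ R ε) (measure_ne_top _ _)
    _ ≤ ∑ k ∈ K, μ.real (Metric.closedBall ((θ + 2 * π * k) / t) (ε / |t|)) :=
        measureReal_biUnion_finset_le _ _
    _ ≤ K.card * (A * (2 * (ε / |t|))) := by
        simpa using Finset.sum_le_sum fun k (_ : k ∈ K) => hball k
    _ ≤ (c / π + 1) * (A * (2 * (ε / |t|))) := by gcongr

lemma three_sixteenths_le_of_le_smul_volume (hA : 0 ≤ A) (hμ : μ ≤ ENNReal.ofReal A • volume)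
    (hint : Integrable (fun x => x ^ 2) μ) (hvar : ∫ x, x ^ 2 ∂μ ≤ 1) : 3 / 16 ≤ A := by
  have hmass := measureReal_le_mul_volume hA hμ (s := Icc (-2) 2) (by simp)
  rw [Real.volume_real_Icc_of_le (by norm_num)] at hmass
  linarith [three_quarters_le_measureReal_Icc hint hvar]

lemma measureReal_near_period_le_of_three_le_sq (hμ : μ ≤ ENNReal.ofReal A • volume)
    (hA : 3 / 16 ≤ A) {t : ℝ} (ht : 3 ≤ t ^ 2) (θ : ℝ) :
    μ.real {x | |x| ≤ 2 ∧ ∃ k : ℤ, |t * x - θ - 2 * π * k| ≤ 1 / (8 * A)} ≤ 7 / 20 := by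
  have hA₀ : 0 < A := by linarith
  have ht₀ : t ≠ 0 := by rintro rfl; norm_num at ht
  have htabs : 17 / 10 ≤ |t| :=
    (sq_le_sq₀ (by norm_num) (abs_nonneg t)).1 (by rw [sq_abs]; linarith)
  have hε : 1 / (8 * A) ≤ 2 / 3 := by
    rw [div_le_div_iff₀ (by positivity) (by norm_num)]; linarith
  calc μ.real {x | |x| ≤ 2 ∧ ∃ k : ℤ, |t * x - θ - 2 * π * k| ≤ 1 / (8 * A)}
      ≤ ((2 * |t| + 1 / (8 * A)) / π + 1) * (A * (2 * (1 / (8 * A) / |t|))) :=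
        measureReal_near_period_le hA₀.le hμ ht₀ θ zero_le_two (by positivity)
    _ = 1 / 4 * (2 / π + (1 / (8 * A) / π + 1) * (1 / |t|)) := by
        have : |t| ≠ 0 := abs_ne_zero.2 ht₀
        field_simp
        ring
    _ ≤ 1 / 4 * (2 / 3 + (2 / 3 / 3 + 1) * (1 / (17 / 10))) := by
        gcongr <;> exact pi_gt_three.le
    _ ≤ 7 / 20 := by norm_num

theorem norm_charFun_le_exp (hA : 0 ≤ A) (hμ : μ ≤ ENNReal.ofReal A • volume)
    (hint : Integrable (fun x => x ^ 2) μ) (hvar : ∫ x, x ^ 2 ∂μ ≤ 1) {t : ℝ} (ht : 3 ≤ t ^ 2) :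
    ‖charFun μ t‖ ≤ rexp (-(1 / (96 * A ^ 2 * (2 + π) ^ 2))) := by
  have hA' : 3 / 16 ≤ A := three_sixteenths_le_of_le_smul_volume hA hμ hint hvar
  have : 0 < A := by linarith
  obtain ⟨θ, hθ⟩ := exists_norm_charFun_eq_integral_cos μ t
  set ε := 1 / (8 * A) with hε
  set B := {x | |x| ≤ 2 ∧ ∃ k : ℤ, |t * x - θ - 2 * π * k| ≤ ε}
  have hmass : 2 / 5 ≤ μ.real (Icc (-2) 2 \ B) := by
    linarith [le_measureReal_sdiff (μ := μ) (s₁ := Icc (-2) 2) (s₂ := B),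
      measureReal_near_period_le_of_three_le_sq hμ hA' ht θ,
      three_quarters_le_measureReal_Icc hint hvar]
  have hcos : ∀ x ∈ Icc (-2) 2 \ B, 2 * ε ^ 2 / π ^ 2 ≤ 1 - cos (t * x - θ) := by
    rintro x ⟨hx, hxB⟩
    refine two_mul_sq_div_pi_sq_le_one_sub_cos (by positivity) fun k => ?_
    by_contra! hk
    exact hxB ⟨abs_le.2 hx, k, hk⟩
  have hgap : 1 / (96 * A ^ 2 * (2 + π) ^ 2) ≤ 1 - ‖charFun μ t‖ := by
    calc 1 / (96 * A ^ 2 * (2 + π) ^ 2) ≤ 1 / (80 * A ^ 2 * π ^ 2) := by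
          gcongr
          · norm_num
          · linarith
      _ = 2 * ε ^ 2 / π ^ 2 * (2 / 5) := by rw [hε]; field_simp; norm_num
      _ ≤ 2 * ε ^ 2 / π ^ 2 * μ.real (Icc (-2) 2 \ B) := by gcongr
      _ ≤ 1 - ‖charFun μ t‖ :=
          mul_measureReal_le_one_sub_norm_charFun hθ (by positivity) hcos
  linarith [add_one_le_exp (-(1 / (96 * A ^ 2 * (2 + π) ^ 2)))]

end BoundedDensity

/-- The remainder of order `n` in the Taylor expansion of the complex exponential at `0`; the
subtracted polynomial has degree `n - 1`. -/
noncomputable def expRemainder (n : ℕ) (z : ℂ) : ℂ :=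
  Complex.exp z - ∑ k ∈ Finset.range n, z ^ k / k.factorial

lemma hasDerivAt_expRemainder_succ (n : ℕ) (z : ℂ) :
    HasDerivAt (expRemainder (n + 1)) (expRemainder n z) z := by
  have hpow : ∀ k ∈ Finset.range n, HasDerivAt (fun z : ℂ => z ^ (k + 1) / ((k + 1).factorial : ℂ))
      (z ^ k / k.factorial) z := by
    intro k _
    refine ((hasDerivAt_pow (k + 1) z).div_const _).congr_deriv ?_
    rw [Nat.factorial_succ, Nat.add_sub_cancel]
    push_cast
    field_simp
  refine ((Complex.hasDerivAt_exp z).sub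
    ((HasDerivAt.fun_sum hpow).add_const 1)).congr_of_eventuallyEq (.of_forall fun w => ?_)
  simp [expRemainder, Finset.sum_range_succ']

lemma expRemainder_succ_zero (n : ℕ) : expRemainder (n + 1) 0 = 0 := by
  simp [expRemainder, Finset.sum_range_succ']

lemma norm_expRemainder_le (n : ℕ) {z : ℂ} (hz : z.re ≤ 0) :
    ‖expRemainder n z‖ ≤ ‖z‖ ^ n / n.factorial := by
  induction n generalizing z with
  | zero => simpa [expRemainder, Complex.norm_exp] using hz
  | succ n ih =>
    have hderiv : ∀ u : ℝ,
        HasDerivAt (fun u : ℝ => expRemainder (n + 1) (u * z)) (expRemainder n (u * z) * z) u := by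
      intro u
      refine (hasDerivAt_expRemainder_succ n (u * z)).comp (h := fun u : ℝ => (u : ℂ) * z) u ?_
      simpa using (Complex.ofRealCLM.hasDerivAt (x := u)).mul_const z
    have hbound : ∀ u : ℝ, HasDerivAt (fun u : ℝ => (u * ‖z‖) ^ (n + 1) / (n + 1).factorial)
        ((u * ‖z‖) ^ n / n.factorial * ‖z‖) u := by
      intro u
      refine ((((hasDerivAt_id u).mul_const ‖z‖).pow (n + 1)).div_const _).congr_deriv ?_
      rw [Nat.factorial_succ, Nat.add_sub_cancel]
      push_cast
      field_simp
      simp only [id, mul_comm]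
    have hle : ∀ u ∈ Ico (0 : ℝ) 1,
        ‖expRemainder n (u * z) * z‖ ≤ (u * ‖z‖) ^ n / n.factorial * ‖z‖ := by
      intro u hu
      rw [norm_mul]
      gcongr
      have hre : ((u : ℂ) * z).re ≤ 0 := by
        simpa using mul_nonpos_of_nonneg_of_nonpos hu.1 hz
      simpa [abs_of_nonneg hu.1] using ih hre
    simpa using image_norm_le_of_norm_deriv_right_le_deriv_boundary
      (fun u _ => (hderiv u).continuousAt.continuousWithinAt)
      (fun u _ => (hderiv u).hasDerivWithinAt) (by simp [expRemainder_succ_zero]) hbound hle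
      (right_mem_Icc.2 zero_le_one)

lemma norm_expRemainder_succ_le (n : ℕ) {z : ℂ} (hz : z.re ≤ 0) :
    ‖expRemainder (n + 1) z‖ ≤ 2 * (‖z‖ ^ n / n.factorial) := by
  have hsucc : expRemainder (n + 1) z = expRemainder n z - z ^ n / n.factorial := by
    rw [expRemainder, expRemainder, Finset.sum_range_succ, sub_sub]
  calc ‖expRemainder (n + 1) z‖ ≤ ‖expRemainder n z‖ + ‖z ^ n / n.factorial‖ := by
        rw [hsucc]
        exact norm_sub_le _ _
    _ ≤ ‖z‖ ^ n / n.factorial + ‖z‖ ^ n / n.factorial := by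
        gcongr
        · exact norm_expRemainder_le n hz
        · simp
    _ = 2 * (‖z‖ ^ n / n.factorial) := (two_mul _).symm

section TaylorExpansion

variable {ρ : Measure ℝ}

lemma integrable_mul_mul_I_pow {k : ℕ} (h : Integrable (fun x => x ^ k) ρ) (t : ℝ) :
    Integrable (fun x : ℝ => (t * x * Complex.I) ^ k / (k.factorial : ℂ)) ρ := by
  refine (h.ofReal.const_mul ((t * Complex.I) ^ k / (k.factorial : ℂ))).congr
    (.of_forall fun x => ?_)
  simp only [RCLike.ofReal_pow, Complex.coe_algebraMap]
  ring

variable [IsFiniteMeasure ρ]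

lemma integrable_cexp_mul_I (t : ℝ) :
    Integrable (fun x : ℝ => Complex.exp (t * x * Complex.I)) ρ :=
  (integrable_const (1 : ℝ)).mono' (by fun_prop)
    (.of_forall fun x => (norm_cexp_ofReal_mul_ofReal_mul_I t x).le)

lemma integrable_expRemainder {n : ℕ} (h : ∀ k < n, Integrable (fun x => x ^ k) ρ) (t : ℝ) :
    Integrable (fun x : ℝ => expRemainder n (t * x * Complex.I)) ρ :=
  (integrable_cexp_mul_I t).sub (integrable_finsetSum _ fun k hk =>
    integrable_mul_mul_I_pow (h k (Finset.mem_range.1 hk)) t)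

lemma integral_expRemainder {n : ℕ} (h : ∀ k < n, Integrable (fun x => x ^ k) ρ) (t : ℝ) :
    ∫ x : ℝ, expRemainder n (t * x * Complex.I) ∂ρ = charFun ρ t -
      ∑ k ∈ Finset.range n, (t * Complex.I) ^ k / k.factorial * ((∫ x, x ^ k ∂ρ : ℝ) : ℂ) := by
  have hpow : ∀ k ∈ Finset.range n,
      Integrable (fun x : ℝ => (t * x * Complex.I) ^ k / (k.factorial : ℂ)) ρ :=
    fun k hk => integrable_mul_mul_I_pow (h k (Finset.mem_range.1 hk)) t
  simp only [expRemainder]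
  rw [integral_sub (integrable_cexp_mul_I t) (integrable_finsetSum _ hpow), charFun_apply_real,
    integral_finsetSum _ hpow]
  congr 1
  refine Finset.sum_congr rfl fun k _ => ?_
  rw [← integral_complex_ofReal, ← integral_const_mul]
  congr 1 with x
  push_cast
  ring

end TaylorExpansion

lemma norm_ofReal_mul_ofReal_mul_I (t x : ℝ) : ‖(t * x * Complex.I : ℂ)‖ = |t| * |x| := by
  simp

section SignedDifference

variable {μ ν : Measure ℝ} [IsFiniteMeasure μ] [IsFiniteMeasure ν]

lemma variation_toSignedMeasure_sub_le :
    (μ.toSignedMeasure - ν.toSignedMeasure).variation ≤ μ + ν := by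
  simpa using VectorMeasure.variation_sub_le (μ := μ.toSignedMeasure) (ν := ν.toSignedMeasure)

lemma norm_integral_sub_integral_le {E : Type*} [NormedAddCommGroup E] [NormedSpace ℝ E]
    [CompleteSpace E] {f : ℝ → E} (hμ : Integrable f μ) (hν : Integrable f ν) :
    ‖∫ x, f x ∂μ - ∫ x, f x ∂ν‖ ≤
      ∫ x, ‖f x‖ ∂(μ.toSignedMeasure - ν.toSignedMeasure).variation := by
  have hsub := VectorMeasure.integral_sub_vectorMeasure (μ := μ.toSignedMeasure)
    (ν := ν.toSignedMeasure) (f := f) (B := (ContinuousLinearMap.lsmul ℝ ℝ).flip)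
    (by rwa [VectorMeasure.Integrable, Measure.variation_toSignedMeasure])
    (by rwa [VectorMeasure.Integrable, Measure.variation_toSignedMeasure])
  rw [VectorMeasure.integral_toSignedMeasure, VectorMeasure.integral_toSignedMeasure] at hsub
  rw [← hsub]
  refine VectorMeasure.norm_integral_le_integral_norm.trans ?_
  refine mul_le_of_le_one_left (integral_nonneg fun _ => norm_nonneg _) ?_
  rw [ContinuousLinearMap.opNorm_flip]
  exact ContinuousLinearMap.opNorm_lsmul_le

variable {m : ℕ}

lemma charFun_sub_charFun_eq_integral_expRemainder
    (hμ : ∀ k ≤ m, Integrable (fun x => x ^ k) μ) (hν : ∀ k ≤ m, Integrable (fun x => x ^ k) ν)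
    (heq : ∀ k ≤ m, ∫ x, x ^ k ∂μ = ∫ x, x ^ k ∂ν) (t : ℝ) :
    charFun μ t - charFun ν t = ∫ x : ℝ, expRemainder (m + 1) (t * x * Complex.I) ∂μ -
      ∫ x : ℝ, expRemainder (m + 1) (t * x * Complex.I) ∂ν := by
  rw [integral_expRemainder (fun k hk => hμ k (Nat.lt_succ_iff.1 hk)),
    integral_expRemainder (fun k hk => hν k (Nat.lt_succ_iff.1 hk)),
    Finset.sum_congr rfl fun k hk => by rw [heq k (Finset.mem_range_succ_iff.1 hk)],
    sub_sub_sub_cancel_right]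

lemma setIntegral_norm_expRemainder_le (ρ : Measure ℝ) [IsFiniteMeasure ρ] (c t : ℝ) :
    ∫ x in {x : ℝ | |x| ≤ c}, ‖expRemainder m (t * x * Complex.I)‖ ∂ρ ≤
      |t| ^ m / m.factorial * ∫ x in {x : ℝ | |x| ≤ c}, |x| ^ m ∂ρ := by
  rw [← integral_const_mul]
  refine integral_mono_of_nonneg (.of_forall fun x => norm_nonneg _) ?_ (.of_forall fun x => ?_)
  · refine Integrable.const_mul ?_ _
    refine (integrable_const (|c| ^ m)).mono' (by fun_prop) ?_
    filter_upwards [ae_restrict_mem (measurableSet_le (by fun_prop) (by fun_prop))] with x hx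
    rw [Real.norm_of_nonneg (by positivity)]
    exact pow_le_pow_left₀ (abs_nonneg _) (le_trans hx (le_abs_self c)) _
  · refine (norm_expRemainder_le m (by simp)).trans_eq ?_
    rw [norm_ofReal_mul_ofReal_mul_I, mul_pow, mul_div_right_comm]

lemma setIntegral_norm_expRemainder_succ_le {ρ : Measure ℝ} (hρ : Integrable (fun x => |x| ^ m) ρ)
    (s : Set ℝ) (t : ℝ) :
    ∫ x in s, ‖expRemainder (m + 1) (t * x * Complex.I)‖ ∂ρ ≤
      2 * (|t| ^ m / m.factorial) * ∫ x in s, |x| ^ m ∂ρ := by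
  rw [← integral_const_mul]
  refine integral_mono_of_nonneg (.of_forall fun x => norm_nonneg _)
    (hρ.integrableOn.const_mul _) (.of_forall fun x => ?_)
  refine (norm_expRemainder_succ_le m (by simp)).trans_eq ?_
  rw [norm_ofReal_mul_ofReal_mul_I, mul_pow, mul_div_right_comm]
  exact (mul_assoc _ _ _).symm

theorem norm_charFun_sub_charFun_le (hμ : ∀ k ≤ m, Integrable (fun x => x ^ k) μ)
    (hν : ∀ k ≤ m, Integrable (fun x => x ^ k) ν)
    (heq : ∀ k ≤ m, ∫ x, x ^ k ∂μ = ∫ x, x ^ k ∂ν) (c t : ℝ) :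
    ‖charFun μ t - charFun ν t‖ ≤
      |t| ^ (m + 1) / (m + 1).factorial * (∫ x in {x : ℝ | |x| ≤ c}, |x| ^ (m + 1)
        ∂(μ.toSignedMeasure - ν.toSignedMeasure).variation) +
      2 * (|t| ^ m / m.factorial) * (∫ x in {x : ℝ | c < |x|}, |x| ^ m
        ∂(μ.toSignedMeasure - ν.toSignedMeasure).variation) := by
  set V := (μ.toSignedMeasure - ν.toSignedMeasure).variation
  have hV : V ≤ μ + ν := variation_toSignedMeasure_sub_le
  have : IsFiniteMeasure V := isFiniteMeasure_of_le _ hV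
  have hremμ := integrable_expRemainder (fun k hk => hμ k (Nat.lt_succ_iff.1 hk)) t
  have hremν := integrable_expRemainder (fun k hk => hν k (Nat.lt_succ_iff.1 hk)) t
  have hpow : Integrable (fun x => |x| ^ m) V := by
    simpa [abs_pow] using (((hμ m le_rfl).add_measure (hν m le_rfl)).mono_measure hV).abs
  have hmeas : MeasurableSet {x : ℝ | |x| ≤ c} := measurableSet_le (by fun_prop) (by fun_prop)
  have hcompl : {x : ℝ | |x| ≤ c}ᶜ = {x : ℝ | c < |x|} := by ext x; simp
  calc ‖charFun μ t - charFun ν t‖ ≤ ∫ x : ℝ, ‖expRemainder (m + 1) (t * x * Complex.I)‖ ∂V := by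
        rw [charFun_sub_charFun_eq_integral_expRemainder hμ hν heq]
        exact norm_integral_sub_integral_le hremμ hremν
    _ = (∫ x in {x : ℝ | |x| ≤ c}, ‖expRemainder (m + 1) (t * x * Complex.I)‖ ∂V) +
          ∫ x in {x : ℝ | c < |x|}, ‖expRemainder (m + 1) (t * x * Complex.I)‖ ∂V := by
        rw [← integral_add_compl hmeas ((hremμ.add_measure hremν).mono_measure hV).norm, hcompl]
    _ ≤ _ := add_le_add (setIntegral_norm_expRemainder_le V c t)
        (setIntegral_norm_expRemainder_succ_le hpow _ t)

end SignedDifference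

section ExponentialSeries

lemma factorial_le_pow_mul_factorial_two_mul {k : ℕ} (hk : 2 ≤ k) :
    27 / 16 * (k.factorial : ℝ) ≤ (3 / 8) ^ k * ((2 * k).factorial : ℝ) := by
  induction k, hk using Nat.le_induction with
  | base => norm_num [Nat.factorial]
  | succ k hk ih =>
    have hk' : (2 : ℝ) ≤ k := by exact_mod_cast hk
    have hfactorial : ((2 * (k + 1)).factorial : ℝ) =
        (2 * k + 2) * ((2 * k + 1) * (2 * k).factorial) := by
      rw [show 2 * (k + 1) = 2 * k + 1 + 1 by ring, Nat.factorial_succ, Nat.factorial_succ]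
      push_cast
      ring
    calc 27 / 16 * ((k + 1).factorial : ℝ) = (k + 1) * (27 / 16 * k.factorial) := by
          rw [Nat.factorial_succ]; push_cast; ring
      _ ≤ (3 / 8 * (2 * k + 2) * (2 * k + 1)) * ((3 / 8) ^ k * ((2 * k).factorial : ℝ)) := by
          gcongr
          nlinarith
      _ = (3 / 8) ^ (k + 1) * ((2 * (k + 1)).factorial : ℝ) := by
          rw [hfactorial, pow_succ]; ring

lemma pow_two_mul_div_factorial_le {k : ℕ} (hk : 2 ≤ k) (s : ℝ) :
    27 / 16 * (s ^ (2 * k) / (2 * k).factorial) ≤ (3 * s ^ 2 / 8) ^ k / k.factorial := by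
  rw [← mul_div_assoc, div_le_div_iff₀ (by positivity) (by positivity)]
  calc 27 / 16 * s ^ (2 * k) * k.factorial = (s ^ 2) ^ k * (27 / 16 * k.factorial) := by
        rw [pow_mul]; ring
    _ ≤ (s ^ 2) ^ k * ((3 / 8) ^ k * ((2 * k).factorial : ℝ)) :=
        mul_le_mul_of_nonneg_left (factorial_le_pow_mul_factorial_two_mul hk) (by positivity)
    _ = (3 * s ^ 2 / 8) ^ k * (2 * k).factorial := by
        rw [show 3 * s ^ 2 / 8 = 3 / 8 * s ^ 2 by ring, mul_pow]; ring

lemma three_quarters_mul_pow_two_mul_div_factorial_le {k : ℕ} (hk : 1 ≤ k) (s : ℝ) :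
    3 / 4 * (s ^ (2 * k) / (2 * k).factorial) ≤ (3 * s ^ 2 / 8) ^ k / k.factorial := by
  rcases hk.eq_or_lt with rfl | hk
  · norm_num [Nat.factorial]
    linarith
  · have hnonneg : 0 ≤ s ^ (2 * k) / ((2 * k).factorial : ℝ) := by rw [pow_mul]; positivity
    linarith [pow_two_mul_div_factorial_le hk s]

lemma pow_div_factorial_add_le_exp_sub_one {k : ℕ} (hk : 1 ≤ k) {a : ℝ} (ha : 0 ≤ a) :
    a ^ k / k.factorial + a ^ (k + 1) / (k + 1).factorial ≤ rexp a - 1 := by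
  obtain ⟨j, rfl⟩ := Nat.exists_eq_add_of_le' hk
  have hsum := Real.sum_le_exp_of_nonneg ha (j + 1 + 2)
  rw [Finset.sum_range_succ, Finset.sum_range_succ, Finset.sum_range_succ'] at hsum
  have hnonneg : 0 ≤ ∑ i ∈ Finset.range j, a ^ (i + 1) / ((i + 1).factorial : ℝ) :=
    Finset.sum_nonneg fun i _ => by positivity
  simp only [pow_zero, Nat.factorial_zero, Nat.cast_one, div_one] at hsum
  linarith

lemma pow_two_mul_add_one_div_factorial_le {k : ℕ} (hk : 1 ≤ k) (s : ℝ) :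
    s ^ (2 * k + 1) / ((2 * k + 1).factorial : ℝ) ≤ 1 / 2 * (s ^ (2 * k) / (2 * k).factorial) +
      2 / 3 * (s ^ (2 * k + 2) / (2 * k + 2).factorial) := by
  -- With `r = s / (2k + 1)` the three terms are in the ratio `r : 1 : r² (2k + 1) / (2k + 2)`.
  have hk' : (1 : ℝ) ≤ k := by exact_mod_cast hk
  set P := s ^ (2 * k) / ((2 * k).factorial : ℝ) with hP
  have hP₀ : 0 ≤ P := by rw [hP, pow_mul]; positivity
  have hodd : s ^ (2 * k + 1) / ((2 * k + 1).factorial : ℝ) = P * (s / (2 * k + 1)) := by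
    rw [hP, Nat.factorial_succ, pow_succ]
    push_cast
    field_simp
  have heven : s ^ (2 * k + 2) / ((2 * k + 2).factorial : ℝ) =
      P * (s / (2 * k + 1)) ^ 2 * ((2 * k + 1) / (2 * k + 2)) := by
    rw [hP, Nat.factorial_succ, Nat.factorial_succ, pow_add]
    push_cast
    field_simp
    ring
  have hratio : 3 / 4 ≤ (2 * (k : ℝ) + 1) / (2 * k + 2) := by
    rw [div_le_div_iff₀ (by norm_num) (by positivity)]
    linarith
  rw [hodd, heven]
  set r := s / (2 * (k : ℝ) + 1)
  calc P * r ≤ P * ((1 + r ^ 2) / 2) := by gcongr; linarith [two_mul_le_add_sq 1 r]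
    _ = 1 / 2 * P + 2 / 3 * (P * r ^ 2 * (3 / 4)) := by ring
    _ ≤ 1 / 2 * P + 2 / 3 * (P * r ^ 2 * ((2 * k + 1) / (2 * k + 2))) := by gcongr

lemma two_mul_pow_div_factorial_add_le {m : ℕ} (hm : 3 ≤ m) {s : ℝ} (hs : 0 ≤ s) :
    2 * (s ^ m / m.factorial) + s ^ (m + 1) / (m + 1).factorial ≤
      2 * (rexp (3 * s ^ 2 / 8) - 1) := by
  have hnonneg : ∀ k, 0 ≤ s ^ k / (k.factorial : ℝ) := fun k => by positivity
  obtain ⟨k, rfl | rfl⟩ := m.even_or_odd'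
  all_goals
    have hexp := pow_div_factorial_add_le_exp_sub_one (k := k) (a := 3 * s ^ 2 / 8) (by omega)
      (by positivity)
    have hodd := pow_two_mul_add_one_div_factorial_le (k := k) (by omega) s
    have hsucc := pow_two_mul_div_factorial_le (k := k + 1) (by omega) s
    rw [mul_add_one] at hsucc
  · linarith [pow_two_mul_div_factorial_le (k := k) (by omega) s, hnonneg (2 * k),
      hnonneg (2 * k + 2)]
  · linarith [three_quarters_mul_pow_two_mul_div_factorial_le (k := k) (by omega) s,
      hnonneg (2 * k), hnonneg (2 * k + 2)]

end ExponentialSeries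

lemma norm_pow_sub_pow_le {R : Type*} [NormedCommRing R] [NormOneClass R] {a b : R} {M : ℝ}
    (ha : ‖a‖ ≤ M) (hb : ‖b‖ ≤ M) (n : ℕ) :
    ‖a ^ n - b ^ n‖ ≤ n * ‖a - b‖ * M ^ (n - 1) := by
  have hM : 0 ≤ M := (norm_nonneg a).trans ha
  have hterm : ∀ i ∈ Finset.range n, ‖a ^ i * b ^ (n - 1 - i)‖ ≤ M ^ (n - 1) := by
    intro i hi
    calc ‖a ^ i * b ^ (n - 1 - i)‖ ≤ ‖a‖ ^ i * ‖b‖ ^ (n - 1 - i) :=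
          (norm_mul_le _ _).trans (by gcongr <;> exact norm_pow_le _ _)
      _ ≤ M ^ i * M ^ (n - 1 - i) := by gcongr
      _ = M ^ (n - 1) := by rw [← pow_add, Nat.add_sub_of_le (by grind)]
  calc ‖a ^ n - b ^ n‖ = ‖(∑ i ∈ Finset.range n, a ^ i * b ^ (n - 1 - i)) * (a - b)‖ := by
        rw [geom_sum₂_mul]
    _ ≤ ‖∑ i ∈ Finset.range n, a ^ i * b ^ (n - 1 - i)‖ * ‖a - b‖ := norm_mul_le _ _
    _ ≤ n * M ^ (n - 1) * ‖a - b‖ := by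
        gcongr
        simpa using norm_sum_le_of_le _ hterm
    _ = n * ‖a - b‖ * M ^ (n - 1) := by ring

lemma integral_abs_pow_mul_exp_neg_mul_sq (k : ℕ) {b : ℝ} (hb : 0 < b) :
    ∫ x : ℝ, |x| ^ k * rexp (-b * x ^ 2) =
      b ^ (-((k : ℝ) + 1) / 2) * Gamma (((k : ℝ) + 1) / 2) := by
  have habs := integral_comp_abs (f := fun x : ℝ => x ^ k * rexp (-b * x ^ 2))
  have hrpow := integral_rpow_mul_exp_neg_mul_rpow (p := 2) (q := k) two_pos
    (by linarith [k.cast_nonneg (α := ℝ)]) hb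
  simp only [rpow_natCast, rpow_two] at hrpow
  simp only [sq_abs] at habs
  rw [habs, hrpow]
  ring

lemma integrable_abs_pow_mul_exp_neg_mul_sq (k : ℕ) {b : ℝ} (hb : 0 < b) :
    Integrable fun x : ℝ => |x| ^ k * rexp (-b * x ^ 2) := by
  simpa [abs_mul, abs_pow] using
    (integrable_rpow_mul_exp_neg_mul_sq hb (s := k) (by linarith [k.cast_nonneg (α := ℝ)])).norm

section PowerDifference

lemma norm_ofReal_exp (x : ℝ) : ‖(rexp x : ℂ)‖ = rexp x := by
  rw [Complex.norm_real, Real.norm_of_nonneg (exp_pos x).le]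

variable {z : ℂ} {m n : ℕ} {t ν₁ ν₂ ν b : ℝ}

lemma norm_sub_exp_le_exp_sub_exp (hm : 3 ≤ m) (hν₁ : ν₁ ≤ ν) (hν₂ : ν₂ ≤ ν)
    (hdiff : ‖z - (rexp (-(t ^ 2 / 2)) : ℂ)‖ ≤
      |t| ^ (m + 1) / (m + 1).factorial * ν₁ + 2 * (|t| ^ m / m.factorial) * ν₂)
    (hν : 0 ≤ ν) (hcentral : 2 * ν ≤ rexp (-(t ^ 2 / 2))) :
    ‖z - (rexp (-(t ^ 2 / 2)) : ℂ)‖ ≤ rexp (-(t ^ 2 / 8)) - rexp (-(t ^ 2 / 2)) := by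
  have hseries := two_mul_pow_div_factorial_add_le hm (abs_nonneg t)
  rw [sq_abs] at hseries
  have hexp : 0 ≤ rexp (3 * t ^ 2 / 8) - 1 := sub_nonneg.2 (one_le_exp (by positivity))
  calc ‖z - (rexp (-(t ^ 2 / 2)) : ℂ)‖
      ≤ |t| ^ (m + 1) / (m + 1).factorial * ν + 2 * (|t| ^ m / m.factorial) * ν :=
        hdiff.trans (by gcongr)
    _ = (2 * (|t| ^ m / m.factorial) + |t| ^ (m + 1) / (m + 1).factorial) * ν := by ring
    _ ≤ 2 * (rexp (3 * t ^ 2 / 8) - 1) * ν := by gcongr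
    _ = (rexp (3 * t ^ 2 / 8) - 1) * (2 * ν) := by ring
    _ ≤ (rexp (3 * t ^ 2 / 8) - 1) * rexp (-(t ^ 2 / 2)) := by gcongr
    _ = rexp (-(t ^ 2 / 8)) - rexp (-(t ^ 2 / 2)) := by
        rw [sub_mul, ← Real.exp_add, one_mul]
        ring_nf

lemma norm_pow_sub_exp_pow_le_of_norm_sub_le (hn : 3 ≤ n)
    (hz : ‖z - (rexp (-(t ^ 2 / 2)) : ℂ)‖ ≤ rexp (-(t ^ 2 / 8)) - rexp (-(t ^ 2 / 2))) :
    ‖z ^ n - (rexp (-(t ^ 2 / 2)) : ℂ) ^ n‖ ≤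
      n * ‖z - (rexp (-(t ^ 2 / 2)) : ℂ)‖ * rexp (-(n / 12 : ℝ) * t ^ 2) := by
  have hz_norm : ‖z‖ ≤ rexp (-(t ^ 2 / 8)) := by
    have htriangle := norm_le_norm_add_norm_sub' z (rexp (-(t ^ 2 / 2)) : ℂ)
    rw [norm_ofReal_exp] at htriangle
    linarith
  have hexp_norm : ‖(rexp (-(t ^ 2 / 2)) : ℂ)‖ ≤ rexp (-(t ^ 2 / 8)) := by
    rw [norm_ofReal_exp]
    exact sub_nonneg.1 ((norm_nonneg _).trans hz)
  refine (norm_pow_sub_pow_le hz_norm hexp_norm n).trans ?_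
  gcongr
  rw [← Real.exp_nat_mul, Real.exp_le_exp, Nat.cast_sub (by omega)]
  have hn' : (3 : ℝ) ≤ n := by exact_mod_cast hn
  push_cast
  nlinarith [sq_nonneg t]

lemma norm_pow_sub_exp_pow_le_of_exp_le (hn : 2 ≤ n) (hz : ‖z‖ ≤ b) (ht : 3 ≤ t ^ 2)
    (htail : rexp (-(t ^ 2 / 2)) ≤ 2 * ν) :
    ‖z ^ n - (rexp (-(t ^ 2 / 2)) : ℂ) ^ n‖ ≤
      b ^ (n - 2) * ‖z‖ ^ 2 +
        2 * ν * rexp (-(3 / 2)) ^ (n - 2) * rexp (-(1 / 2 : ℝ) * t ^ 2) := by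
  obtain ⟨k, rfl⟩ := Nat.exists_eq_add_of_le' hn
  have hhalf : -(1 / 2 : ℝ) * t ^ 2 = -(t ^ 2 / 2) := by ring
  rw [Nat.add_sub_cancel, hhalf]
  refine (norm_sub_le _ _).trans (add_le_add ?_ ?_)
  · rw [norm_pow, pow_add]
    gcongr
  · calc ‖(rexp (-(t ^ 2 / 2)) : ℂ) ^ (k + 2)‖
        = rexp (-(t ^ 2 / 2)) * rexp (-(t ^ 2 / 2)) ^ k * rexp (-(t ^ 2 / 2)) := by
          rw [norm_pow, norm_ofReal_exp]
          ring
      _ ≤ 2 * ν * rexp (-(3 / 2)) ^ k * rexp (-(t ^ 2 / 2)) := by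
          gcongr
          exact (exp_pos _).le.trans htail

/-- An integrable majorant of `t ↦ ‖f t ^ n - exp (-t² / 2) ^ n‖ / |t|`. The two `ν₁`, `ν₂` terms
dominate where `2 ν ≤ exp (-t² / 2)`; the other two where `2 ν > exp (-t² / 2)`, and there `b`
bounds `‖f t‖`. -/
noncomputable def powMajorant (f : ℝ → ℂ) (m n : ℕ) (ν₁ ν₂ ν b t : ℝ) : ℝ :=
  (n * ν₁ / (m + 1).factorial * (|t| ^ m * rexp (-(n / 12 : ℝ) * t ^ 2)) +
      2 * n * ν₂ / m.factorial * (|t| ^ (m - 1) * rexp (-(n / 12 : ℝ) * t ^ 2))) +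
    (b ^ (n - 2) * ‖f t‖ ^ 2 +
      2 * ν * rexp (-(3 / 2)) ^ (n - 2) * (|t| ^ 1 * rexp (-(1 / 2 : ℝ) * t ^ 2)))

variable {f : ℝ → ℂ}

lemma norm_pow_sub_exp_pow_div_le_powMajorant_of_le (hm : 3 ≤ m) (hn : 3 ≤ n) (hν₁ : ν₁ ≤ ν)
    (hν₂ : ν₂ ≤ ν) (hν : 0 ≤ ν) (hb : 0 ≤ b) (ht : 0 < |t|)
    (hdiff : ‖f t - (rexp (-(t ^ 2 / 2)) : ℂ)‖ ≤
      |t| ^ (m + 1) / (m + 1).factorial * ν₁ + 2 * (|t| ^ m / m.factorial) * ν₂)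
    (hcentral : 2 * ν ≤ rexp (-(t ^ 2 / 2))) :
    ‖f t ^ n - (rexp (-(t ^ 2 / 2)) : ℂ) ^ n‖ / |t| ≤ powMajorant f m n ν₁ ν₂ ν b t := by
  have hpow : |t| ^ m = |t| ^ (m - 1) * |t| := (pow_sub_one_mul (by omega) _).symm
  refine le_add_of_le_of_nonneg ?_ (by positivity)
  rw [div_le_iff₀ ht]
  calc ‖f t ^ n - (rexp (-(t ^ 2 / 2)) : ℂ) ^ n‖
      ≤ n * ‖f t - (rexp (-(t ^ 2 / 2)) : ℂ)‖ * rexp (-(n / 12 : ℝ) * t ^ 2) :=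
        norm_pow_sub_exp_pow_le_of_norm_sub_le hn
          (norm_sub_exp_le_exp_sub_exp hm hν₁ hν₂ hdiff hν hcentral)
    _ ≤ n * (|t| ^ (m + 1) / (m + 1).factorial * ν₁ + 2 * (|t| ^ m / m.factorial) * ν₂) *
          rexp (-(n / 12 : ℝ) * t ^ 2) := by gcongr
    _ = _ := by
        rw [pow_succ, hpow]
        ring

lemma norm_pow_sub_exp_pow_div_le_powMajorant_of_lt (hn : 2 ≤ n) (hν₁ : 0 ≤ ν₁) (hν₂ : 0 ≤ ν₂)
    (hν : 2 * ν ≤ rexp (-(3 / 2))) (hb : 3 ≤ t ^ 2 → ‖f t‖ ≤ b)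
    (htail : rexp (-(t ^ 2 / 2)) < 2 * ν) :
    ‖f t ^ n - (rexp (-(t ^ 2 / 2)) : ℂ) ^ n‖ / |t| ≤ powMajorant f m n ν₁ ν₂ ν b t := by
  have ht : 3 ≤ t ^ 2 := by linarith [Real.exp_lt_exp.1 (htail.trans_le hν)]
  have ht_one : 1 ≤ |t| := one_le_sq_iff_one_le_abs t |>.1 (by linarith)
  have : 0 ≤ b := (norm_nonneg _).trans (hb ht)
  have hν₀ : 0 ≤ ν := by linarith [exp_pos (-(t ^ 2 / 2))]
  refine le_add_of_nonneg_of_le (by positivity) ?_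
  calc ‖f t ^ n - (rexp (-(t ^ 2 / 2)) : ℂ) ^ n‖ / |t|
      ≤ ‖f t ^ n - (rexp (-(t ^ 2 / 2)) : ℂ) ^ n‖ := div_le_self (norm_nonneg _) ht_one
    _ ≤ b ^ (n - 2) * ‖f t‖ ^ 2 +
          2 * ν * rexp (-(3 / 2)) ^ (n - 2) * rexp (-(1 / 2 : ℝ) * t ^ 2) :=
        norm_pow_sub_exp_pow_le_of_exp_le hn (hb ht) ht htail.le
    _ ≤ _ := by
        gcongr
        rw [pow_one]
        exact le_mul_of_one_le_left (exp_pos _).le ht_one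

lemma norm_pow_sub_exp_pow_div_le_powMajorant (hm : 3 ≤ m) (hn : 3 ≤ n) (hν₁ : 0 ≤ ν₁)
    (hν₂ : 0 ≤ ν₂) (hν₁ν : ν₁ ≤ ν) (hν₂ν : ν₂ ≤ ν) (hν : 2 * ν ≤ rexp (-(3 / 2))) (hb : 0 ≤ b)
    (hdiff : ‖f t - (rexp (-(t ^ 2 / 2)) : ℂ)‖ ≤
      |t| ^ (m + 1) / (m + 1).factorial * ν₁ + 2 * (|t| ^ m / m.factorial) * ν₂)
    (hfb : 3 ≤ t ^ 2 → ‖f t‖ ≤ b) :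
    ‖f t ^ n - (rexp (-(t ^ 2 / 2)) : ℂ) ^ n‖ / |t| ≤ powMajorant f m n ν₁ ν₂ ν b t := by
  have hν₀ : 0 ≤ ν := hν₁.trans hν₁ν
  rcases eq_or_ne t 0 with rfl | ht
  · rw [abs_zero, div_zero, powMajorant]
    positivity
  rcases le_or_gt (2 * ν) (rexp (-(t ^ 2 / 2))) with hcentral | htail
  · exact norm_pow_sub_exp_pow_div_le_powMajorant_of_le hm hn hν₁ν hν₂ν hν₀ hb (abs_pos.2 ht)
      hdiff hcentral
  · exact norm_pow_sub_exp_pow_div_le_powMajorant_of_lt (by omega) hν₁ hν₂ hν hfb htail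

lemma integrable_powMajorant (hn : 0 < n) (hf : Integrable fun t => ‖f t‖ ^ 2) :
    Integrable (powMajorant f m n ν₁ ν₂ ν b) := by
  have hn12 : (0 : ℝ) < n / 12 := by positivity
  exact (((integrable_abs_pow_mul_exp_neg_mul_sq m hn12).const_mul _).add
    ((integrable_abs_pow_mul_exp_neg_mul_sq (m - 1) hn12).const_mul _)).add
    ((hf.const_mul _).add ((integrable_abs_pow_mul_exp_neg_mul_sq 1 one_half_pos).const_mul _))

lemma integral_powMajorant (hn : 0 < n) (hf : Integrable fun t => ‖f t‖ ^ 2) :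
    ∫ t, powMajorant f m n ν₁ ν₂ ν b t =
      (n * ν₁ / (m + 1).factorial * (∫ t : ℝ, |t| ^ m * rexp (-(n / 12 : ℝ) * t ^ 2)) +
        2 * n * ν₂ / m.factorial * ∫ t : ℝ, |t| ^ (m - 1) * rexp (-(n / 12 : ℝ) * t ^ 2)) +
      (b ^ (n - 2) * (∫ t, ‖f t‖ ^ 2) + 2 * ν * rexp (-(3 / 2)) ^ (n - 2) *
        ∫ t : ℝ, |t| ^ 1 * rexp (-(1 / 2 : ℝ) * t ^ 2)) := by
  have hn12 : (0 : ℝ) < n / 12 := by positivity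
  have hν₁_int := (integrable_abs_pow_mul_exp_neg_mul_sq m hn12).const_mul
    (n * ν₁ / (m + 1).factorial)
  have hν₂_int := (integrable_abs_pow_mul_exp_neg_mul_sq (m - 1) hn12).const_mul
    (2 * n * ν₂ / m.factorial)
  have hf_int := hf.const_mul (b ^ (n - 2))
  have hν_int := (integrable_abs_pow_mul_exp_neg_mul_sq 1 one_half_pos).const_mul
    (2 * ν * rexp (-(3 / 2)) ^ (n - 2))
  simp only [powMajorant]
  rw [integral_add (hν₁_int.fun_add hν₂_int) (hf_int.fun_add hν_int), integral_add hν₁_int hν₂_int,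
    integral_add hf_int hν_int]
  simp only [integral_const_mul]

end PowerDifference

lemma inv_two_pi_mul_integral_eq_C1 (k : ℕ) {n : ℕ} (hn : 0 < n) (a : ℝ) :
    (2 * π)⁻¹ * (n * a / (k + 1).factorial * ∫ x : ℝ, |x| ^ k * rexp (-(n / 12 : ℝ) * x ^ 2)) =
      1 / 2 * C1 k * (a / (n : ℝ) ^ (((k : ℝ) - 1) / 2)) := by
  have hn' : (0 : ℝ) < n := by exact_mod_cast hn
  have hrpow : (n / 12 : ℝ) ^ (-((k : ℝ) + 1) / 2) =
      (12 : ℝ) ^ (((k : ℝ) + 1) / 2) / (n * (n : ℝ) ^ (((k : ℝ) - 1) / 2)) := by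
    rw [neg_div, rpow_neg (by positivity), div_rpow hn'.le (by norm_num), inv_div]
    congr 1
    rw [show ((k : ℝ) + 1) / 2 = 1 + ((k : ℝ) - 1) / 2 by ring, rpow_add hn', rpow_one]
  rw [integral_abs_pow_mul_exp_neg_mul_sq k (by positivity), C1, hrpow]
  field_simp

lemma inv_two_pi_mul_integral_eq_C2 {m n : ℕ} (hm : 1 ≤ m) (hn : 0 < n) (a : ℝ) :
    (2 * π)⁻¹ * (2 * n * a / m.factorial *
      ∫ x : ℝ, |x| ^ (m - 1) * rexp (-(n / 12 : ℝ) * x ^ 2)) =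
      1 / 2 * C2 m * (a / (n : ℝ) ^ (((m : ℝ) - 2) / 2)) := by
  obtain ⟨k, rfl⟩ := Nat.exists_eq_add_of_le' hm
  have hcast : (((k + 1 : ℕ) : ℝ) - 2) / 2 = ((k : ℝ) - 1) / 2 := by push_cast; ring
  have hC1 := inv_two_pi_mul_integral_eq_C1 k hn a
  rw [hcast, C2, Nat.add_sub_cancel]
  linear_combination 2 * hC1

lemma C1_nonneg (m : ℕ) : 0 ≤ C1 m := by
  have : 0 < Gamma (((m : ℝ) + 1) / 2) := Gamma_pos_of_pos (by positivity)
  rw [C1]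
  positivity

lemma C2_nonneg (m : ℕ) : 0 ≤ C2 m := mul_nonneg two_pos.le (C1_nonneg _)

lemma exp_neg_pow_sub_two_le {n : ℕ} (hn : 2 ≤ n) :
    rexp (-(3 / 2)) ^ (n - 2) ≤ rexp (3 / 2) * rexp (-((n : ℝ) / 2)) * (2 / n) := by
  have hn' : (2 : ℝ) ≤ n := by exact_mod_cast hn
  have hinv : rexp (-((n : ℝ) - 3 / 2)) ≤ 2 / n := by
    rw [Real.exp_neg, inv_le_comm₀ (exp_pos _) (by positivity), inv_div]
    linarith [Real.add_one_le_exp ((n : ℝ) - 3 / 2)]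
  calc rexp (-(3 / 2)) ^ (n - 2)
      = rexp (3 / 2) * rexp (-((n : ℝ) / 2)) * rexp (-((n : ℝ) - 3 / 2)) := by
        rw [← Real.exp_nat_mul, ← Real.exp_add, ← Real.exp_add, Nat.cast_sub hn]
        congr 1
        push_cast
        ring
    _ ≤ rexp (3 / 2) * rexp (-((n : ℝ) / 2)) * (2 / n) := by gcongr

lemma inv_two_pi_mul_gaussian_tail_le {n : ℕ} (hn : 2 ≤ n) {ν : ℝ} (hν : 0 ≤ ν) :
    (2 * π)⁻¹ * (2 * ν * rexp (-(3 / 2)) ^ (n - 2) *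
      ∫ x : ℝ, |x| ^ 1 * rexp (-(1 / 2 : ℝ) * x ^ 2)) ≤
      ν * (4 * rexp (3 / 2) / π) * (rexp (-((n : ℝ) / 2)) / n) := by
  have hint : ∫ x : ℝ, |x| ^ 1 * rexp (-(1 / 2 : ℝ) * x ^ 2) = 2 := by
    rw [integral_abs_pow_mul_exp_neg_mul_sq 1 (by norm_num)]
    norm_num
  calc (2 * π)⁻¹ * (2 * ν * rexp (-(3 / 2)) ^ (n - 2) *
        ∫ x : ℝ, |x| ^ 1 * rexp (-(1 / 2 : ℝ) * x ^ 2))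
      = 2 * ν / π * rexp (-(3 / 2)) ^ (n - 2) := by
        rw [hint]
        field_simp
    _ ≤ 2 * ν / π * (rexp (3 / 2) * rexp (-((n : ℝ) / 2)) * (2 / n)) := by
        gcongr
        exact exp_neg_pow_sub_two_le hn
    _ = ν * (4 * rexp (3 / 2) / π) * (rexp (-((n : ℝ) / 2)) / n) := by ring

lemma inv_two_pi_mul_integral_powMajorant_le {f : ℝ → ℂ} {m n : ℕ} {ν₁ ν₂ ν b A : ℝ}
    (hm : 1 ≤ m) (hn : 2 ≤ n) (hν₁ : 0 ≤ ν₁) (hν₂ : 0 ≤ ν₂) (hν : 0 ≤ ν) (hb : 0 ≤ b) (hA : 0 ≤ A)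
    (hf : Integrable fun t => ‖f t‖ ^ 2) (hfA : ∫ t, ‖f t‖ ^ 2 ≤ 2 * π * A) :
    (2 * π)⁻¹ * ∫ t, powMajorant f m n ν₁ ν₂ ν b t ≤
      2 * C1 m * (ν₁ / (n : ℝ) ^ (((m : ℝ) - 1) / 2))
        + 2 * C2 m * (ν₂ / (n : ℝ) ^ (((m : ℝ) - 2) / 2))
        + 2 * A * b ^ (n - 2)
        + ν * (4 * rexp (3 / 2) / π) * (rexp (-((n : ℝ) / 2)) / (n : ℝ)) := by
  have hL2 : (2 * π)⁻¹ * (b ^ (n - 2) * ∫ t, ‖f t‖ ^ 2) ≤ A * b ^ (n - 2) := by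
    calc (2 * π)⁻¹ * (b ^ (n - 2) * ∫ t, ‖f t‖ ^ 2)
        ≤ (2 * π)⁻¹ * (b ^ (n - 2) * (2 * π * A)) := by gcongr
      _ = A * b ^ (n - 2) := by field_simp
  have hC1 : 0 ≤ C1 m * (ν₁ / (n : ℝ) ^ (((m : ℝ) - 1) / 2)) :=
    mul_nonneg (C1_nonneg m) (by positivity)
  have hC2 : 0 ≤ C2 m * (ν₂ / (n : ℝ) ^ (((m : ℝ) - 2) / 2)) :=
    mul_nonneg (C2_nonneg m) (by positivity)
  have hAb : 0 ≤ A * b ^ (n - 2) := by positivity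
  rw [integral_powMajorant (by omega) hf, mul_add, mul_add, mul_add,
    inv_two_pi_mul_integral_eq_C1 m (by omega), inv_two_pi_mul_integral_eq_C2 hm (by omega)]
  linarith [inv_two_pi_mul_gaussian_tail_le hn hν]

lemma charFun_gaussianReal_zero_one (t : ℝ) :
    charFun (gaussianReal 0 1) t = (rexp (-(t ^ 2 / 2)) : ℂ) := by
  rw [charFun_gaussianReal]
  push_cast
  congr 1
  ring

lemma integrable_pow_gaussianReal (v : ℝ≥0) (k : ℕ) :
    Integrable (fun x : ℝ => x ^ k) (gaussianReal 0 v) := by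
  rw [← integrable_norm_iff (by fun_prop)]
  simpa using (memLp_id_gaussianReal (μ := 0) (v := v) k).integrable_norm_pow'

lemma integral_sq_gaussianReal (v : ℝ≥0) : ∫ x, x ^ 2 ∂(gaussianReal 0 v) = v := by
  simpa using (variance_of_integral_eq_zero aemeasurable_id' integral_id_gaussianReal).symm.trans
    (variance_fun_id_gaussianReal (μ := 0) (v := v))

lemma norm_pow_sub_charFun_gaussianReal_div (f : ℝ → ℂ) {n : ℕ} (hn : 0 < n) (t : ℝ) :
    ‖f ((√n)⁻¹ * t) ^ n - charFun (gaussianReal 0 1) t‖ / |t| =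
      (√n)⁻¹ * (‖f ((√n)⁻¹ * t) ^ n - (rexp (-(((√n)⁻¹ * t) ^ 2 / 2)) : ℂ) ^ n‖ /
        |(√n)⁻¹ * t|) := by
  have hn' : (0 : ℝ) < n := by exact_mod_cast hn
  have hsqrt : 0 < √(n : ℝ) := Real.sqrt_pos.2 hn'
  have hexp : (rexp (-(((√n)⁻¹ * t) ^ 2 / 2)) : ℂ) ^ n = charFun (gaussianReal 0 1) t := by
    rw [charFun_gaussianReal_zero_one, ← Complex.ofReal_pow, ← Real.exp_nat_mul, mul_pow, inv_pow,
      Real.sq_sqrt hn'.le]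
    congr 3
    field_simp
  rw [hexp, abs_mul, abs_of_pos (inv_pos.2 hsqrt)]
  field_simp

lemma abs_cdf_sub_cdf_gaussianReal_le_integral {ρ : Measure ℝ} [IsProbabilityMeasure ρ]
    {f : ℝ → ℂ} {n : ℕ} (hn : 0 < n) (hρ : Integrable (fun x => x) ρ)
    (hchar : ∀ t, charFun ρ t = f ((√n)⁻¹ * t) ^ n)
    (hf : Integrable fun t => ‖f t ^ n - (rexp (-(t ^ 2 / 2)) : ℂ) ^ n‖ / |t|) (x : ℝ) :
    |cdf ρ x - cdf (gaussianReal 0 1) x| ≤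
      (2 * π)⁻¹ * ∫ t, ‖f t ^ n - (rexp (-(t ^ 2 / 2)) : ℂ) ^ n‖ / |t| := by
  have hsqrt : 0 < √(n : ℝ) := Real.sqrt_pos.2 (by exact_mod_cast hn)
  set g : ℝ → ℝ := fun t => ‖f t ^ n - (rexp (-(t ^ 2 / 2)) : ℂ) ^ n‖ / |t|
  have hscale : (fun t => ‖charFun ρ t - charFun (gaussianReal 0 1) t‖ / |t|) =
      fun t => (√n)⁻¹ * g ((√n)⁻¹ * t) := by
    ext t
    rw [hchar, norm_pow_sub_charFun_gaussianReal_div f hn]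
  have hint : Integrable fun t => ‖charFun ρ t - charFun (gaussianReal 0 1) t‖ / |t| := by
    rw [hscale]
    exact (hf.comp_mul_left' (inv_ne_zero hsqrt.ne')).const_mul _
  refine (abs_cdf_sub_cdf_le hρ (by simpa using integrable_pow_gaussianReal 1 1) hint x).trans_eq ?_
  rw [hscale, integral_const_mul, Measure.integral_comp_mul_left, inv_inv, abs_of_pos hsqrt,
    smul_eq_mul, inv_mul_cancel_left₀ hsqrt.ne']

theorem abs_cdf_sub_cdf_gaussianReal_le {μ ρ : Measure ℝ} [IsProbabilityMeasure μ]
    [IsProbabilityMeasure ρ] {A : ℝ} (hA : 0 ≤ A) (hμ : μ ≤ ENNReal.ofReal A • volume)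
    {m n : ℕ} (hm : 3 ≤ m) (hn : 3 ≤ n) (hmom : ∀ k ≤ m, Integrable (fun x => x ^ k) μ)
    (heq : ∀ k ≤ m, ∫ x, x ^ k ∂μ = ∫ x, x ^ k ∂(gaussianReal 0 1))
    (hρ : Integrable (fun x => x) ρ)
    (hchar : ∀ t, charFun ρ t = charFun μ ((√n)⁻¹ * t) ^ n) {c ν₁ ν₂ ν : ℝ}
    (hν₁ : ν₁ = ∫ x in {x : ℝ | |x| ≤ c}, |x| ^ (m + 1)
      ∂(μ.toSignedMeasure - (gaussianReal 0 1).toSignedMeasure).variation)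
    (hν₂ : ν₂ = ∫ x in {x : ℝ | c < |x|}, |x| ^ m
      ∂(μ.toSignedMeasure - (gaussianReal 0 1).toSignedMeasure).variation)
    (hν₁ν : ν₁ ≤ ν) (hν₂ν : ν₂ ≤ ν) (hν : 2 * ν ≤ rexp (-(3 / 2))) (x : ℝ) :
    |cdf ρ x - cdf (gaussianReal 0 1) x| ≤
      2 * C1 m * (ν₁ / (n : ℝ) ^ (((m : ℝ) - 1) / 2))
        + 2 * C2 m * (ν₂ / (n : ℝ) ^ (((m : ℝ) - 2) / 2))
        + 2 * A * rexp (-(1 / (96 * A ^ 2 * (2 + π) ^ 2))) ^ (n - 2)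
        + ν * (4 * rexp (3 / 2) / π) * (rexp (-((n : ℝ) / 2)) / (n : ℝ)) := by
  have hν₁_nonneg : 0 ≤ ν₁ := hν₁ ▸ integral_nonneg fun _ => by positivity
  have hν₂_nonneg : 0 ≤ ν₂ := hν₂ ▸ integral_nonneg fun _ => by positivity
  have hν_nonneg : 0 ≤ ν := hν₁_nonneg.trans hν₁ν
  set b := rexp (-(1 / (96 * A ^ 2 * (2 + π) ^ 2)))
  have hb : 0 ≤ b := (exp_pos _).le
  have hvar : ∫ x, x ^ 2 ∂μ ≤ 1 := by
    rw [heq 2 (by omega), integral_sq_gaussianReal, NNReal.coe_one]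
  have hdiff (t : ℝ) : ‖charFun μ t - (rexp (-(t ^ 2 / 2)) : ℂ)‖ ≤
      |t| ^ (m + 1) / (m + 1).factorial * ν₁ + 2 * (|t| ^ m / m.factorial) * ν₂ := by
    rw [← charFun_gaussianReal_zero_one, hν₁, hν₂]
    exact norm_charFun_sub_charFun_le hmom (fun k _ => integrable_pow_gaussianReal 1 k) heq c t
  have hmajorant (t : ℝ) := norm_pow_sub_exp_pow_div_le_powMajorant hm hn hν₁_nonneg hν₂_nonneg
    hν₁ν hν₂ν hν hb (hdiff t) (norm_charFun_le_exp hA hμ (hmom 2 (by omega)) hvar)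
  have hsq := integrable_norm_charFun_sq hA hμ
  have hmajorant_int : Integrable (powMajorant (charFun μ) m n ν₁ ν₂ ν b) :=
    integrable_powMajorant (by omega) hsq
  have hint : Integrable fun t => ‖charFun μ t ^ n - (rexp (-(t ^ 2 / 2)) : ℂ) ^ n‖ / |t| := by
    refine hmajorant_int.mono' ?_ (.of_forall fun t => ?_)
    · have : Measurable (charFun μ) := measurable_charFun
      exact Measurable.aestronglyMeasurable (by fun_prop)
    · rw [Real.norm_of_nonneg (by positivity)]
      exact hmajorant t
  calc |cdf ρ x - cdf (gaussianReal 0 1) x|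
      ≤ (2 * π)⁻¹ * ∫ t, ‖charFun μ t ^ n - (rexp (-(t ^ 2 / 2)) : ℂ) ^ n‖ / |t| :=
        abs_cdf_sub_cdf_gaussianReal_le_integral (by omega) hρ hchar hint x
    _ ≤ (2 * π)⁻¹ * ∫ t, powMajorant (charFun μ) m n ν₁ ν₂ ν b t :=
        mul_le_mul_of_nonneg_left (integral_mono hint hmajorant_int hmajorant) (by positivity)
    _ ≤ _ := inv_two_pi_mul_integral_powMajorant_le (by omega) (by omega) hν₁_nonneg hν₂_nonneg
        hν_nonneg hb hA hsq (integral_norm_charFun_sq_le hA hμ)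

lemma withDensity_ofReal_le_smul {α : Type*} [MeasurableSpace α] {μ : Measure α} {p : α → ℝ}
    {A : ℝ} (hp : ∀ x, p x ≤ A) :
    (μ.withDensity fun x => ENNReal.ofReal (p x)) ≤ ENNReal.ofReal A • μ := by
  rw [← withDensity_const]
  exact withDensity_mono (.of_forall fun x => ENNReal.ofReal_le_ofReal (hp x))

lemma pos_of_le_ofReal_smul {α : Type*} [MeasurableSpace α] {μ ν : Measure α} [NeZero μ] {A : ℝ}
    (h : μ ≤ ENNReal.ofReal A • ν) : 0 < A := by
  by_contra! hA
  rw [ENNReal.ofReal_of_nonpos hA, zero_smul] at h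
  exact NeZero.ne μ (Measure.nonpos_iff_eq_zero'.1 h)

lemma map_div_le_smul_volume {L : Measure ℝ} {A σ : ℝ} (hσ : 0 < σ)
    (hL : L ≤ ENNReal.ofReal A • volume) :
    L.map (fun x => x / σ) ≤ ENNReal.ofReal (σ * A) • volume := by
  refine Measure.le_iff.2 fun s hs => ?_
  rw [Measure.map_apply (by fun_prop) hs]
  refine (hL _).trans_eq ?_
  simp only [Measure.smul_apply, smul_eq_mul, div_eq_mul_inv]
  rw [Real.volume_preimage_mul_right (inv_ne_zero hσ.ne'), inv_inv, abs_of_pos hσ,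
    ENNReal.ofReal_mul hσ.le]
  ring

lemma b1_eq_exp (A σ : ℝ) : b1 A σ = rexp (-(1 / (96 * (σ * A) ^ 2 * (2 + π) ^ 2))) := by
  rw [b1, mul_pow, mul_comm (σ ^ 2), mul_assoc 96]

lemma b1_lt_one {A σ : ℝ} (hA : 0 < A) (hσ : 0 < σ) : b1 A σ < 1 := by
  rw [b1, Real.exp_lt_one_iff, neg_lt_zero]
  positivity

section Pseudomoments

variable {L : Measure ℝ} {σ : ℝ} {k : ℕ}

lemma PseudomomentExists.integrable_pow [IsFiniteMeasure L] (h : PseudomomentExists L σ k) :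
    Integrable (fun x => x ^ k) (L.map fun x => x / σ) := by
  have hgauss : (gaussianReal 0 1).toSignedMeasure.Integrable fun x : ℝ => x ^ k := by
    rw [VectorMeasure.Integrable, Measure.variation_toSignedMeasure]
    exact integrable_pow_gaussianReal 1 k
  have hsum := VectorMeasure.Integrable.add_vectorMeasure h hgauss
  rwa [dH, sub_add_cancel, VectorMeasure.Integrable, Measure.variation_toSignedMeasure] at hsum

lemma pseudomoment_eq_sub [IsFiniteMeasure L]
    (hL : Integrable (fun x => x ^ k) (L.map fun x => x / σ)) :
    pseudomoment L σ k =
      ∫ x, x ^ k ∂(L.map fun x => x / σ) - ∫ x, x ^ k ∂(gaussianReal 0 1) := by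
  have hgauss := integrable_pow_gaussianReal 1 k
  rw [pseudomoment, dH, VectorMeasure.integral_sub_vectorMeasure
    (by rwa [VectorMeasure.Integrable, Measure.variation_toSignedMeasure])
    (by rwa [VectorMeasure.Integrable, Measure.variation_toSignedMeasure]),
    VectorMeasure.integral_toSignedMeasure, VectorMeasure.integral_toSignedMeasure]

lemma integrable_pow_map_div_of_le_two [IsFiniteMeasure L] (hL : MemLp id 2 L) (hk : k ≤ 2) :
    Integrable (fun x => x ^ k) (L.map fun x => x / σ) := by
  rw [integrable_map_measure (by fun_prop) (by fun_prop)]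
  have hpow : Integrable (fun x => x ^ k) L := by
    rw [← integrable_norm_iff (by fun_prop)]
    simpa using (hL.mono_exponent (p := k) (by exact_mod_cast hk)).integrable_norm_pow'
  simpa only [Function.comp_def, div_pow] using hpow.div_const (σ ^ k)

lemma integral_pow_map_div_eq_of_le_two [IsProbabilityMeasure L] (hσ : σ ≠ 0)
    (hmean : ∫ x, x ∂L = 0) (hvar : variance id L = σ ^ 2) (hk : k ≤ 2) :
    ∫ x, x ^ k ∂(L.map fun x => x / σ) = ∫ x, x ^ k ∂(gaussianReal 0 1) := by
  rw [integral_map (by fun_prop) (by fun_prop)]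
  simp only [div_pow, integral_div]
  interval_cases k
  · simp
  · simp [hmean]
  · rw [variance_of_integral_eq_zero aemeasurable_id hmean] at hvar
    simp only [id_eq] at hvar
    rw [hvar, integral_sq_gaussianReal, NNReal.coe_one, div_self (by positivity)]

theorem abs_cdf_sub_cdf_gaussianReal_le_of_pseudomoment_eq_zero [IsProbabilityMeasure L]
    {ρ : Measure ℝ} [IsProbabilityMeasure ρ] {A : ℝ} {m n : ℕ} (hσ : 0 < σ) (hL : MemLp id 2 L)
    (hmean : ∫ x, x ∂L = 0) (hvar : variance id L = σ ^ 2) (hLA : L ≤ ENNReal.ofReal A • volume)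
    (hm : 3 ≤ m) (hexists : ∀ k, 3 ≤ k → k ≤ m → PseudomomentExists L σ k)
    (hzero : ∀ k, 3 ≤ k → k ≤ m → pseudomoment L σ k = 0) (hn : 3 ≤ n)
    (hnu : nu L σ n m < 1 / 2 * rexp (-(3 / 2))) (hρ : Integrable (fun x => x) ρ)
    (hchar : ∀ t, charFun ρ t = charFun (L.map fun x => x / σ) ((√n)⁻¹ * t) ^ n) (x : ℝ) :
    |cdf ρ x - cdf (gaussianReal 0 1) x| ≤
      2 * C1 m * (nu1 L σ n m / (n : ℝ) ^ (((m : ℝ) - 1) / 2))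
        + 2 * C2 m * (nu2 L σ n m / (n : ℝ) ^ (((m : ℝ) - 2) / 2))
        + 2 * σ * A * b1 A σ ^ (n - 2)
        + nu L σ n m * (4 * rexp (3 / 2) / π) * (rexp (-((n : ℝ) / 2)) / (n : ℝ)) := by
  have : IsProbabilityMeasure (L.map fun x => x / σ) :=
    Measure.isProbabilityMeasure_map (by fun_prop)
  have hmom : ∀ k ≤ m, Integrable (fun x => x ^ k) (L.map fun x => x / σ) := fun k hk =>
    (le_or_gt k 2).elim (integrable_pow_map_div_of_le_two hL) fun hk₃ =>
      (hexists k hk₃ hk).integrable_pow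
  have heq : ∀ k ≤ m, ∫ x, x ^ k ∂(L.map fun x => x / σ) = ∫ x, x ^ k ∂(gaussianReal 0 1) :=
    fun k hk => (le_or_gt k 2).elim (integral_pow_map_div_eq_of_le_two hσ.ne' hmean hvar)
      fun hk₃ => sub_eq_zero.1 ((pseudomoment_eq_sub (hmom k hk)).symm.trans (hzero k hk₃ hk))
  have hnu₂ : 2 * nu L σ n m ≤ rexp (-(3 / 2)) := by linarith
  rw [b1_eq_exp, mul_assoc 2 σ A]
  exact abs_cdf_sub_cdf_gaussianReal_le (mul_pos hσ (pos_of_le_ofReal_smul hLA)).le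
    (map_div_le_smul_volume hσ hLA) hm hn hmom heq hρ hchar rfl rfl (le_max_left _ _)
    (le_max_right _ _) hnu₂ x

end Pseudomoments

section NormalizedSum

variable {Ω : Type*} [MeasurableSpace Ω] {P : Measure Ω} {ξ : ℕ → Ω → ℝ}

lemma integrable_S (hident : ∀ i, IdentDistrib (ξ i) (ξ 0) P P) (hint : Integrable (ξ 0) P)
    (σ : ℝ) (n : ℕ) : Integrable (S ξ σ n) P :=
  (integrable_finsetSum _ fun i _ => (hident i).symm.integrable_snd hint).const_mul _

lemma charFun_map_S [IsProbabilityMeasure P] (hindep : iIndepFun ξ P)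
    (hident : ∀ i, IdentDistrib (ξ i) (ξ 0) P P) (σ : ℝ) (n : ℕ) (t : ℝ) :
    charFun (P.map (S ξ σ n)) t =
      charFun ((P.map (ξ 0)).map fun x => x / σ) ((√n)⁻¹ * t) ^ n := by
  have hdiv : Measurable fun x : ℝ => x / σ := by fun_prop
  have hS : S ξ σ n = fun ω => (√n)⁻¹ * ∑ i ∈ Finset.range n, ξ i ω / σ := by
    ext ω
    rw [S, ← Finset.sum_div, mul_inv]
    ring
  rw [hS, AEMeasurable.map_map_of_aemeasurable hdiv.aemeasurable (hident 0).aemeasurable_fst]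
  exact charFun_inv_sqrt_mul_sum (X := fun i ω => ξ i ω / σ)
    (hindep.comp (fun _ x => x / σ) fun _ => hdiv) (fun i => (hident i).comp hdiv)

end NormalizedSum

end PseudoCLT

open PseudoCLT in
theorem corollary1 {Ω : Type*} [MeasurableSpace Ω] (P : Measure Ω) [IsProbabilityMeasure P]
    (ξ : ℕ → Ω → ℝ) (σ : ℝ) (hσ : 0 < σ)
    -- i.i.d. random variables with mean `0` and variance `σ²`
    (hindep : iIndepFun ξ P) (hident : ∀ i, IdentDistrib (ξ i) (ξ 0) P P)
    (hL2 : MemLp (ξ 0) 2 P) (hmean : ∫ ω, ξ 0 ω ∂P = 0) (hvar : variance (ξ 0) P = σ ^ 2)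
    -- the common law has a density `p ≤ A₁`
    (p : ℝ → ℝ) (A₁ : ℝ) (hp_meas : Measurable p) (hp_nonneg : ∀ x, 0 ≤ p x)
    (hp_dens : P.map (ξ 0) = volume.withDensity (fun x => ENNReal.ofReal (p x)))
    (hp_le : ∀ x, p x ≤ A₁)
    -- vanishing pseudomoments up to order `m`, bounded truncated pseudomoments
    (m : ℕ) (hm : 3 ≤ m)
    (hexists : ∀ k, 3 ≤ k → k ≤ m → PseudoCLT.PseudomomentExists (P.map (ξ 0)) σ k)
    (hzero : ∀ k, 3 ≤ k → k ≤ m → PseudoCLT.pseudomoment (P.map (ξ 0)) σ k = 0)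
    (n : ℕ) (hn : 3 ≤ n)
    (hnu : PseudoCLT.nu (P.map (ξ 0)) σ n m < 1 / 2 * Real.exp (-(3 / 2))) :
    PseudoCLT.b1 A₁ σ < 1 ∧
    (⨆ x : ℝ, |cdf (P.map (PseudoCLT.S ξ σ n)) x - cdf (gaussianReal 0 1) x|) ≤
      2 * PseudoCLT.C1 m *
          (PseudoCLT.nu1 (P.map (ξ 0)) σ n m / (n : ℝ) ^ (((m : ℝ) - 1) / 2))
        + 2 * PseudoCLT.C2 m *
          (PseudoCLT.nu2 (P.map (ξ 0)) σ n m / (n : ℝ) ^ (((m : ℝ) - 2) / 2))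
        + 2 * σ * A₁ * PseudoCLT.b1 A₁ σ ^ (n - 2)
        + PseudoCLT.nu (P.map (ξ 0)) σ n m * (4 * Real.exp (3 / 2) / Real.pi)
          * (Real.exp (-((n : ℝ) / 2)) / (n : ℝ)) := by
  have hξ : AEMeasurable (ξ 0) P := (hident 0).aemeasurable_fst
  have : IsProbabilityMeasure (P.map (ξ 0)) := Measure.isProbabilityMeasure_map hξ
  have hdens : P.map (ξ 0) ≤ ENNReal.ofReal A₁ • volume :=
    hp_dens.trans_le (withDensity_ofReal_le_smul hp_le)
  have hLp : MemLp id 2 (P.map (ξ 0)) :=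
    (memLp_map_measure_iff (by fun_prop) hξ).2 hL2
  have hmean_law : ∫ x, x ∂(P.map (ξ 0)) = 0 := by rwa [integral_map hξ (by fun_prop)]
  have hvar_law : variance id (P.map (ξ 0)) = σ ^ 2 := by rwa [variance_id_map hξ]
  have hS : Integrable (S ξ σ n) P := integrable_S hident (hL2.integrable one_le_two) σ n
  have : IsProbabilityMeasure (P.map (S ξ σ n)) :=
    Measure.isProbabilityMeasure_map hS.aemeasurable
  have hS_law : Integrable (fun x => x) (P.map (S ξ σ n)) :=
    (integrable_map_measure (by fun_prop) hS.aemeasurable).2 hS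
  exact ⟨b1_lt_one (pos_of_le_ofReal_smul hdens) hσ, ciSup_le fun x =>
    abs_cdf_sub_cdf_gaussianReal_le_of_pseudomoment_eq_zero hσ hLp hmean_law hvar_law hdens hm
      hexists hzero hn hnu hS_law (charFun_map_S hindep hident σ n) x⟩
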